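/- All difference rings are inversive: a difference ring is a commutative ring with a ring automorphism $\sigma$, and a $\sigma$-ideal is an ideal $I$ with $\sigma(I)=I$ (and similarly for $\sigma^\ell$). Let $k_0$ be an algebraically closed difference field, let $K$ and $\Omega$ be difference fields extending $k_0$, and let $a_1,\dots,a_n$ be finite tuples of elements of $\Omega$. For $\ell\ge 1$ let $k_0(a_i)_{\sigma^\ell}$ be the subfield of $\Omega$ generated over $k_0$ by the tuples $\sigma^{\ell j}(a_i)$, $j\in\mathbb Z$. The coordinate rings associated to the quantifier-free types of $a_1,\dots,a_n$ over $k_0$ are $$R=K\otimes_{k_0}k_0(a_1)\otimes_{k_0}\cdots\otimes_{k_0}k_0(a_n)\subseteq R_{\sigma^\ell}=K\otimes_{k_0}k_0(a_1)_{\sigma^\ell}\otimes_{k_0}\cdots\otimes_{k_0}k_0(a_n)_{\sigma^\ell}\subseteq R_\sigma=R_{\sigma^1},$$ and $\sigma$ acts on $R_\sigma$ through its action on each factor. Let $S_\sigma=R[c]_\sigma$ be a difference ring which is an integral domain, contains $R_\sigma$ as a difference subring, and is generated as a difference ring by $R_\sigma$ and a finite tuple $c$ such that $S=R[c]$ is integral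 over $R$. For $\ell\ge1$ let $S_{\sigma^\ell}=R[c]_{\sigma^\ell}$ be the $\sigma^\ell$-difference subring of $S_\sigma$ generated by $R_{\sigma^\ell}$ and $c$. If $P$ is a prime $\sigma$-ideal of $R_\sigma$, then for some $\ell\ge 1$ the ideal $P\cap R_{\sigma^\ell}$ extends to a prime $\sigma^\ell$-ideal of $S_{\sigma^\ell}$; that is, there is a prime ideal $Q$ of $S_{\sigma^\ell}$ with $\sigma^\ell(Q)=Q$ and $Q\cap R_{\sigma^\ell}=P\cap R_{\sigma^\ell}$. -/

import Mathlib

open scoped TensorProduct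

noncomputable section

/-! All difference rings are inversive: a difference ring is a commutative ring `A` with a ring
automorphism `σ : A ≃+* A`.  The power `σ ^ j`, `j : ℤ`, is taken in the group of automorphisms. -/

/-- `(B, σB)` is a difference ring over `(A, σA)`: the structure map commutes with the
automorphisms. -/
def IsDifferenceExt {A B : Type*} [CommRing A] [CommRing B] [Algebra A B]
    (σA : A ≃+* A) (σB : B ≃+* B) : Prop :=
  ∀ x, σB (algebraMap A B x) = algebraMap A B (σA x)

/-- A (reflexive) `σ`-ideal: an ideal `I` with `σ(I) = I`. -/
def IsSigmaIdeal {A : Type*} [CommRing A] (σ : A ≃+* A) (I : Ideal A) : Prop :=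
  I.map σ = I

/-- The inversive difference subring of `(A, σ)` generated by a subset `X`. -/
def diffSubring {A : Type*} [CommRing A] (σ : A ≃+* A) (X : Set A) : Subring A :=
  Subring.closure {y | ∃ (j : ℤ) (x : A), x ∈ X ∧ y = (σ ^ j) x}

theorem subset_diffSubring {A : Type*} [CommRing A] (σ : A ≃+* A) (X : Set A) :
    X ⊆ diffSubring σ X :=
  fun x hx => Subring.subset_closure ⟨0, x, hx, by simp⟩

theorem zpow_mem_diffSubring {A : Type*} [CommRing A] (σ : A ≃+* A) (X : Set A) (i : ℤ) {x : A}
    (hx : x ∈ diffSubring σ X) : (σ ^ i) x ∈ diffSubring σ X := by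
  unfold diffSubring at hx
  induction hx using Subring.closure_induction with
  | mem y hy =>
    obtain ⟨j, z, hz, rfl⟩ := hy
    refine Subring.subset_closure ⟨i + j, z, hz, ?_⟩
    rw [zpow_add]; rfl
  | zero => simp [zero_mem]
  | one => simp [one_mem]
  | add x y _ _ h1 h2 => rw [map_add]; exact add_mem h1 h2
  | neg x _ h => rw [map_neg]; exact neg_mem h
  | mul x y _ _ h1 h2 => rw [map_mul]; exact mul_mem h1 h2

/-- The restriction of `σ` to the difference subring generated by `X`. -/
def diffSubringAut {A : Type*} [CommRing A] (σ : A ≃+* A) (X : Set A) :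
    diffSubring σ X ≃+* diffSubring σ X where
  toFun x := ⟨σ x, by simpa using zpow_mem_diffSubring σ X 1 x.2⟩
  invFun x := ⟨σ.symm x, by
    have h := zpow_mem_diffSubring σ X (-1) x.2
    rw [zpow_neg_one] at h
    exact h⟩
  left_inv x := Subtype.ext (σ.symm_apply_apply x)
  right_inv x := Subtype.ext (σ.apply_symm_apply x)
  map_add' x y := Subtype.ext (map_add σ (x : A) y)
  map_mul' x y := Subtype.ext (map_mul σ (x : A) y)

/-- `k(a)_σ`: the inversive difference subfield of `(Ω, σ)` generated over `k` by the tuple `a`.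
Applied to the automorphism `σ ^ ℓ` it is `k(a)_{σ^ℓ}`. -/
def diffField (k : Type*) {Ω : Type*} [Field k] [Field Ω] [Algebra k Ω] (σ : Ω ≃+* Ω)
    {d : ℕ} (a : Fin d → Ω) : IntermediateField k Ω :=
  IntermediateField.adjoin k {y | ∃ (j : ℤ) (t : Fin d), y = (σ ^ j) (a t)}

section DiffField

variable {k Ω : Type*} [Field k] [Field Ω] [Algebra k Ω] {σk : k ≃+* k} {σ : Ω ≃+* Ω}

theorem IsDifferenceExt.symm {A B : Type*} [CommRing A] [CommRing B] [Algebra A B]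
    {σA : A ≃+* A} {σB : B ≃+* B} (h : IsDifferenceExt σA σB) :
    IsDifferenceExt σA.symm σB.symm := fun x => by
  rw [RingEquiv.symm_apply_eq, h, RingEquiv.apply_symm_apply]

theorem apply_mem_diffField (h : IsDifferenceExt σk σ) {d : ℕ} (a : Fin d → Ω) {x : Ω}
    (hx : x ∈ diffField k σ a) : σ x ∈ diffField k σ a := by
  unfold diffField at hx
  induction hx using IntermediateField.adjoin_induction with
  | mem y hy =>
    obtain ⟨j, t, rfl⟩ := hy
    refine IntermediateField.subset_adjoin k _ ⟨1 + j, t, ?_⟩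
    rw [zpow_add, zpow_one]; rfl
  | algebraMap x => rw [h]; exact IntermediateField.algebraMap_mem _ _
  | add x y _ _ h1 h2 => rw [map_add]; exact add_mem h1 h2
  | inv x _ h => rw [map_inv₀]; exact inv_mem h
  | mul x y _ _ h1 h2 => rw [map_mul]; exact mul_mem h1 h2

theorem symm_apply_mem_diffField (h : IsDifferenceExt σk σ) {d : ℕ} (a : Fin d → Ω) {x : Ω}
    (hx : x ∈ diffField k σ a) : σ.symm x ∈ diffField k σ a := by
  unfold diffField at hx
  induction hx using IntermediateField.adjoin_induction with
  | mem y hy =>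
    obtain ⟨j, t, rfl⟩ := hy
    refine IntermediateField.subset_adjoin k _ ⟨-1 + j, t, ?_⟩
    rw [zpow_add, zpow_neg_one]; rfl
  | algebraMap x => rw [h.symm]; exact IntermediateField.algebraMap_mem _ _
  | add x y _ _ h1 h2 => rw [map_add]; exact add_mem h1 h2
  | inv x _ h => rw [map_inv₀]; exact inv_mem h
  | mul x y _ _ h1 h2 => rw [map_mul]; exact mul_mem h1 h2

/-- The automorphism of the difference field `k(a)_σ`. -/
def diffFieldAut (h : IsDifferenceExt σk σ) {d : ℕ} (a : Fin d → Ω) :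
    diffField k σ a ≃+* diffField k σ a where
  toFun x := ⟨σ x, apply_mem_diffField h a x.2⟩
  invFun x := ⟨σ.symm x, symm_apply_mem_diffField h a x.2⟩
  left_inv x := Subtype.ext (σ.symm_apply_apply x)
  right_inv x := Subtype.ext (σ.apply_symm_apply x)
  map_add' x y := Subtype.ext (map_add σ (x : Ω) y)
  map_mul' x y := Subtype.ext (map_mul σ (x : Ω) y)

theorem diffFieldAut_algebraMap (h : IsDifferenceExt σk σ) {d : ℕ} (a : Fin d → Ω) (x : k) :
    diffFieldAut h a (algebraMap k _ x) = algebraMap k _ (σk x) :=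
  Subtype.ext (h x)

theorem diffFieldAut_symm_algebraMap (h : IsDifferenceExt σk σ) {d : ℕ} (a : Fin d → Ω) (x : k) :
    (diffFieldAut h a).symm (algebraMap k _ x) = algebraMap k _ (σk.symm x) :=
  Subtype.ext (h.symm x)

end DiffField

section PiTensor

variable {ι k : Type*} [Fintype ι] [CommRing k] {A : ι → Type*} [∀ i, CommRing (A i)]
  [∀ i, Algebra k (A i)]

/-- The ring homomorphism `⨂ x_i ↦ ∏ f_i(x_i)` out of a tensor product of `k`-algebras, for ring
homomorphisms `f_i` that restrict to the same homomorphism `g` on `k`. -/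
def piTensorLift {B : Type*} [CommRing B] (g : k →+* B) (f : ∀ i, A i →+* B)
    (h : ∀ i x, f i (algebraMap k (A i) x) = g x) : (⨂[k] i, A i) →+* B :=
  letI : Algebra k B := g.toAlgebra
  (PiTensorProduct.liftAlgHom
    ((MultilinearMap.mkPiAlgebra k ι B).compLinearMap
      fun i => (AlgHom.mk (f i) (h i) : A i →ₐ[k] B).toLinearMap)
    (by simp) (by simp [Finset.prod_mul_distrib])).toRingHom

theorem piTensorLift_tprod {B : Type*} [CommRing B] (g : k →+* B) (f : ∀ i, A i →+* B)
    (h : ∀ i x, f i (algebraMap k (A i) x) = g x) (x : ∀ i, A i) :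
    piTensorLift g f h (PiTensorProduct.tprod k x) = ∏ i, f i (x i) := by
  let : Algebra k B := g.toAlgebra
  exact (PiTensorProduct.lift.tprod _).trans rfl

theorem piTensorLift_algebraMap {B : Type*} [CommRing B] (g : k →+* B) (f : ∀ i, A i →+* B)
    (h : ∀ i x, f i (algebraMap k (A i) x) = g x) (x : k) :
    piTensorLift g f h (algebraMap k _ x) = g x := by
  let : Algebra k B := g.toAlgebra
  exact AlgHom.commutes _ x

theorem prod_singleAlgHom [DecidableEq ι] (x : ∀ i, A i) :
    ∏ i, PiTensorProduct.singleAlgHom (R := k) i (x i) = PiTensorProduct.tprod k x := by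
  simp only [PiTensorProduct.singleAlgHom_apply, MonoidHom.mulSingle_apply]
  rw [← PiTensorProduct.tprod_prod]
  congr 1
  exact Finset.univ_prod_mulSingle x

open Classical in
/-- The semilinear ring endomorphism `⨂ x_i ↦ ⨂ s_i(x_i)`. -/
def piTensorMap (s₀ : k →+* k) (s : ∀ i, A i →+* A i)
    (h : ∀ i x, s i (algebraMap k (A i) x) = algebraMap k (A i) (s₀ x)) :
    (⨂[k] i, A i) →+* (⨂[k] i, A i) :=
  piTensorLift ((algebraMap k _).comp s₀)
    (fun i => (PiTensorProduct.singleAlgHom (R := k) i).toRingHom.comp (s i))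
    (fun i x => by
      simp only [RingHom.comp_apply, h]
      exact (PiTensorProduct.singleAlgHom (R := k) i).commutes (s₀ x))

theorem piTensorMap_tprod (s₀ : k →+* k) (s : ∀ i, A i →+* A i)
    (h : ∀ i x, s i (algebraMap k (A i) x) = algebraMap k (A i) (s₀ x)) (x : ∀ i, A i) :
    piTensorMap s₀ s h (PiTensorProduct.tprod k x) =
      PiTensorProduct.tprod k fun i => s i (x i) := by
  classical
  unfold piTensorMap
  rw [piTensorLift_tprod, ← prod_singleAlgHom]
  refine Finset.prod_congr rfl fun i _ => ?_
  rfl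

theorem piTensorMap_algebraMap (s₀ : k →+* k) (s : ∀ i, A i →+* A i)
    (h : ∀ i x, s i (algebraMap k (A i) x) = algebraMap k (A i) (s₀ x)) (x : k) :
    piTensorMap s₀ s h (algebraMap k _ x) = algebraMap k _ (s₀ x) :=
  piTensorLift_algebraMap _ _ _ x

variable {K : Type*} [CommRing K] [Algebra k K]

/-- The semilinear ring endomorphism `y ⊗ ⨂ x_i ↦ s'(y) ⊗ ⨂ s_i(x_i)` of `K ⊗_k ⨂ A_i`. -/
def tensorMap (s₀ : k →+* k) (s' : K →+* K) (s : ∀ i, A i →+* A i)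
    (h' : ∀ x, s' (algebraMap k K x) = algebraMap k K (s₀ x))
    (h : ∀ i x, s i (algebraMap k (A i) x) = algebraMap k (A i) (s₀ x)) :
    K ⊗[k] (⨂[k] i, A i) →+* K ⊗[k] (⨂[k] i, A i) :=
  Algebra.TensorProduct.mapRingHom s₀ s' (piTensorMap s₀ s h)
    (RingHom.ext h') (RingHom.ext fun x => piTensorMap_algebraMap s₀ s h x)

theorem tensorMap_tmul_tprod (s₀ : k →+* k) (s' : K →+* K) (s : ∀ i, A i →+* A i)
    (h' : ∀ x, s' (algebraMap k K x) = algebraMap k K (s₀ x))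
    (h : ∀ i x, s i (algebraMap k (A i) x) = algebraMap k (A i) (s₀ x)) (y : K) (x : ∀ i, A i) :
    tensorMap s₀ s' s h' h (y ⊗ₜ PiTensorProduct.tprod k x) =
      s' y ⊗ₜ PiTensorProduct.tprod k fun i => s i (x i) := by
  unfold tensorMap
  rw [Algebra.TensorProduct.mapRingHom_tmul, piTensorMap_tprod]

theorem tensorMap_comp (s₀ t₀ : k →+* k) (s' t' : K →+* K) (s t : ∀ i, A i →+* A i)
    (hs' : ∀ x, s' (algebraMap k K x) = algebraMap k K (s₀ x))
    (hs : ∀ i x, s i (algebraMap k (A i) x) = algebraMap k (A i) (s₀ x))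
    (ht' : ∀ x, t' (algebraMap k K x) = algebraMap k K (t₀ x))
    (ht : ∀ i x, t i (algebraMap k (A i) x) = algebraMap k (A i) (t₀ x))
    (e' : ∀ y, s' (t' y) = y) (e : ∀ i y, s i (t i y) = y) :
    (tensorMap s₀ s' s hs' hs).comp (tensorMap t₀ t' t ht' ht) = RingHom.id _ := by
  refine RingHom.ext fun z => ?_
  induction z with
  | zero => simp
  | add x y hx hy => rw [map_add, hx, hy, map_add]
  | tmul y x =>
    induction x using PiTensorProduct.induction_on with
    | smul_tprod q x =>
      rw [← TensorProduct.smul_tmul, RingHom.comp_apply, tensorMap_tmul_tprod,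
        tensorMap_tmul_tprod, e']
      simp [e]
    | add x y hx hy => rw [TensorProduct.tmul_add, map_add, hx, hy, map_add]

end PiTensor

/-- The ring `K ⊗_k ⨂ A_i`. -/
abbrev TensorRing {ι : Type*} (k K : Type*) (A : ι → Type*) [CommRing k] [CommRing K]
    [Algebra k K] [∀ i, CommRing (A i)] [∀ i, Algebra k (A i)] : Type _ :=
  K ⊗[k] (⨂[k] i, A i)

section CoordinateRing

variable {k K Ω : Type*} [Field k] [Field K] [Field Ω] [Algebra k K] [Algebra k Ω]

variable (k K) in
/-- The coordinate ring `R_σ = K ⊗_k k(a₁)_σ ⊗_k ⋯ ⊗_k k(aₙ)_σ` of the quantifier-free types over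
`k` of the finite tuples `a₁, …, aₙ` of the difference field `(Ω, σ)`. -/
def CoordRing (σ : Ω ≃+* Ω) {n : ℕ} {d : Fin n → ℕ} (a : ∀ i, Fin (d i) → Ω) : Type _ :=
  TensorRing k K fun i => diffField k σ (a i)

variable {σk : k ≃+* k} {σK : K ≃+* K} {σ : Ω ≃+* Ω} {n : ℕ} {d : Fin n → ℕ}

instance CoordRing.instCommRing (a : ∀ i, Fin (d i) → Ω) : CommRing (CoordRing k K σ a) :=
  inferInstanceAs (CommRing (TensorRing k K fun i => diffField k σ (a i)))

instance CoordRing.instAlgebra (a : ∀ i, Fin (d i) → Ω) : Algebra K (CoordRing k K σ a) :=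
  inferInstanceAs (Algebra K (TensorRing k K fun i => diffField k σ (a i)))

/-- The pure tensor `y ⊗ x₁ ⊗ ⋯ ⊗ xₙ` in the coordinate ring. -/
def coordTensor (a : ∀ i, Fin (d i) → Ω) (y : K) (x : ∀ i, diffField k σ (a i)) :
    CoordRing k K σ a :=
  (y ⊗ₜ PiTensorProduct.tprod k x : TensorRing k K fun i => diffField k σ (a i))

/-- The automorphism `y ⊗ x₁ ⊗ ⋯ ⊗ xₙ ↦ σ(y) ⊗ σ(x₁) ⊗ ⋯ ⊗ σ(xₙ)` of the coordinate ring. -/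
def coordAut (hK : IsDifferenceExt σk σK) (hΩ : IsDifferenceExt σk σ)
    (a : ∀ i, Fin (d i) → Ω) : CoordRing k K σ a ≃+* CoordRing k K σ a :=
  let f : (TensorRing k K fun i => diffField k σ (a i)) →+* _ :=
    tensorMap (σk : k →+* k) (σK : K →+* K)
      (fun i => (diffFieldAut hΩ (a i) : diffField k σ (a i) →+* diffField k σ (a i)))
      hK (fun i => diffFieldAut_algebraMap hΩ (a i))
  let g : (TensorRing k K fun i => diffField k σ (a i)) →+* _ :=
    tensorMap (σk.symm : k →+* k) (σK.symm : K →+* K)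
      (fun i => ((diffFieldAut hΩ (a i)).symm : diffField k σ (a i) →+* diffField k σ (a i)))
      hK.symm (fun i => diffFieldAut_symm_algebraMap hΩ (a i))
  (RingEquiv.ofRingHom f g
    (tensorMap_comp _ _ _ _ _ _ _ _ _ _ σK.apply_symm_apply
      fun i => (diffFieldAut hΩ (a i)).apply_symm_apply)
    (tensorMap_comp _ _ _ _ _ _ _ _ _ _ σK.symm_apply_apply
      fun i => (diffFieldAut hΩ (a i)).symm_apply_apply) :
    (TensorRing k K fun i => diffField k σ (a i)) ≃+* _)

theorem coordAut_coordTensor (hK : IsDifferenceExt σk σK) (hΩ : IsDifferenceExt σk σ)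
    (a : ∀ i, Fin (d i) → Ω) (y : K) (x : ∀ i, diffField k σ (a i)) :
    coordAut hK hΩ a (coordTensor a y x) =
      coordTensor a (σK y) fun i => diffFieldAut hΩ (a i) (x i) :=
  tensorMap_tmul_tprod (σk : k →+* k) (σK : K →+* K)
    (fun i => (diffFieldAut hΩ (a i) : diffField k σ (a i) →+* diffField k σ (a i)))
    hK (fun i => diffFieldAut_algebraMap hΩ (a i)) y x

variable (K) in
/-- For subfields `E i` of `Ω` over `k`, the `K`-subalgebra of the coordinate ring generated by the
elements of the factors `k(aᵢ)_σ` that lie in `E i`.  When `E i` is contained in `k(aᵢ)_σ` this is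
the tensor product `K ⊗_k E₁ ⊗_k ⋯ ⊗_k Eₙ`, seen inside `R_σ`. -/
def coordSubalgebra (σ : Ω ≃+* Ω) (a : ∀ i, Fin (d i) → Ω) (E : Fin n → IntermediateField k Ω) :
    Subalgebra K (CoordRing k K σ a) :=
  Algebra.adjoin K {y | ∃ (i : Fin n) (x : diffField k σ (a i)), (x : Ω) ∈ E i ∧
    y = coordTensor a 1 (Pi.mulSingle i x)}

variable (k K) in
/-- The ring `R = K ⊗_k k(a₁) ⊗_k ⋯ ⊗_k k(aₙ)`, inside `R_σ`. -/
def coordBase (σ : Ω ≃+* Ω) (a : ∀ i, Fin (d i) → Ω) : Subalgebra K (CoordRing k K σ a) :=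
  coordSubalgebra K σ a fun i => IntermediateField.adjoin k (Set.range (a i))

variable (k K) in
/-- The ring `R_{σ^ℓ} = K ⊗_k k(a₁)_{σ^ℓ} ⊗_k ⋯ ⊗_k k(aₙ)_{σ^ℓ}`, inside `R_σ`. -/
def coordPow (σ : Ω ≃+* Ω) (a : ∀ i, Fin (d i) → Ω) (ℓ : ℕ) :
    Subalgebra K (CoordRing k K σ a) :=
  coordSubalgebra K σ a fun i => diffField k (σ ^ ℓ) (a i)

variable {S : Type*} [CommRing S] {r : ℕ}

variable (k K) in
/-- Generators of `S_{σ^ℓ}` as a `σ^ℓ`-difference ring: the image of `R_{σ^ℓ}` and the tuple `c`. -/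
def extGen (σ : Ω ≃+* Ω) (a : ∀ i, Fin (d i) → Ω) [Algebra (CoordRing k K σ a) S]
    (c : Fin r → S) (ℓ : ℕ) : Set S :=
  algebraMap (CoordRing k K σ a) S '' (coordPow k K σ a ℓ : Set (CoordRing k K σ a)) ∪ Set.range c

variable (k K) in
/-- `S_{σ^ℓ} = R[c]_{σ^ℓ}`: the `σ^ℓ`-difference subring of `S` generated by `R_{σ^ℓ}` and `c`.
Here `τ` is the automorphism of `S` extending the automorphism of `R_σ`. -/
abbrev extPow (σ : Ω ≃+* Ω) (a : ∀ i, Fin (d i) → Ω) [Algebra (CoordRing k K σ a) S]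
    (τ : S ≃+* S) (c : Fin r → S) (ℓ : ℕ) : Subring S :=
  diffSubring (τ ^ ℓ) (extGen k K σ a c ℓ)

variable (k K) in
/-- The automorphism `σ^ℓ` of `S_{σ^ℓ}`. -/
abbrev extPowAut (σ : Ω ≃+* Ω) (a : ∀ i, Fin (d i) → Ω) [Algebra (CoordRing k K σ a) S]
    (τ : S ≃+* S) (c : Fin r → S) (ℓ : ℕ) : extPow k K σ a τ c ℓ ≃+* extPow k K σ a τ c ℓ :=
  diffSubringAut (τ ^ ℓ) (extGen k K σ a c ℓ)

variable (k K) in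
/-- The structure map `R_{σ^ℓ} → S_{σ^ℓ}`. -/
def extPowMap (σ : Ω ≃+* Ω) (a : ∀ i, Fin (d i) → Ω) [Algebra (CoordRing k K σ a) S]
    (τ : S ≃+* S) (c : Fin r → S) (ℓ : ℕ) : coordPow k K σ a ℓ →+* extPow k K σ a τ c ℓ :=
  ((algebraMap (CoordRing k K σ a) S).comp (coordPow k K σ a ℓ).val.toRingHom).codRestrict
    (extPow k K σ a τ c ℓ)
    fun x => subset_diffSubring _ _ (Or.inl ⟨x, x.2, rfl⟩)

end CoordinateRing

end

/-! The ring `A = R_σ` is a domain because it embeds in `S`, and it is normal: an algebraically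
closed field is perfect, and over a perfect field a tensor product of fields that is a domain is
normal (`TensorRing.isIntegrallyClosed`). Also `S` is integral over `A`. Let `B` be the integral
closure of `A` in an algebraic closure of `Frac S`, let `Λ` be an algebraic closure of `Frac (A/P)`,
and extend the automorphisms to `τ` on `B` and `ρ` on `Λ`. An `A`-homomorphism `φ : B → Λ` has a
kernel lying over `P`, but `φ` need not commute with the automorphisms. The aim is to correct `φ` by
elements of `Aut(B/A)` so that it intertwines `τ^ℓ` and `ρ^ℓ` on the ring generated by `A` and the
translates of `c`; the kernel of the corrected map is then the required prime.

Let `Y` be a finite `Aut(B/A)`-stable set containing `c`, and let `z_j : Y → Λ` be `ρ^{-j} φ τ^j`.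
As `A` is normal, `Aut(B/A)` acts transitively on homomorphisms `B → Λ`, on finite sets
(`exists_algEquiv_comp_apply_finset`). So for each `k` the sequence `j ↦ z_{j+k}` is `j ↦ z_j x_j`,
with `x` in a group shift `X ≤ Perm(Y)^ℤ`, the closure of the image of `Aut(B/A)`.

The rest is dynamics of group shifts over a finite group. Let `H` be the group of coordinates of
finitely supported elements of `X`. An element of `X` trivial on a large window has all coordinates
in `H` (`exists_window`), and elements of `H` can be prescribed freely along any sufficiently sparse
progression (`exists_prescribed`). By pigeonhole two of the sequences `x`, for shifts differing by a
large `ℓ`, agree on the window, so `z_{j+ℓ}` and `z_j` differ by an element of `H`. Hence `z_{ℓt} =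
z_0 μ_t` with `μ_t ∈ H`, and an element of `X` equal to `μ_t⁻¹` at each `ℓt` gives the correction
(`exists_periodic`). -/

/-! ### Group shifts over a finite group -/

/-- A group shift: a shift-invariant subgroup of `Γ ^ ℤ` that is closed for the product of the
discrete topologies. -/
structure IsGroupShift {Γ : Type*} [Group Γ] (X : Subgroup (ℤ → Γ)) : Prop where
  mem_of_window : ∀ x : ℤ → Γ, (∀ n : ℕ, ∃ y ∈ X, ∀ j : ℤ, |j| ≤ n → y j = x j) → x ∈ X
  shift_mem : ∀ (k : ℤ), ∀ x ∈ X, (fun j => x (j + k)) ∈ X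

/-- The automorphism `x ↦ (x₋ⱼ)ⱼ` of `Γ ^ ℤ`. -/
def reflectHom (Γ : Type*) [Group Γ] : (ℤ → Γ) →* (ℤ → Γ) where
  toFun x j := x (-j)
  map_one' := rfl
  map_mul' _ _ := rfl

theorem IsGroupShift.reflect {Γ : Type*} [Group Γ] {X : Subgroup (ℤ → Γ)} (hX : IsGroupShift X) :
    IsGroupShift (X.comap (reflectHom Γ)) where
  mem_of_window x h := hX.mem_of_window _ fun n => by
    obtain ⟨y, hy, hxy⟩ := h n
    exact ⟨_, hy, fun j hj => hxy (-j) (by simpa using hj)⟩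
  shift_mem k x hx := by
    have := hX.shift_mem (-k) _ hx
    refine (congrArg (· ∈ X) (funext fun j => ?_)).mp this
    simp [reflectHom, add_comm]

namespace IsGroupShift

variable {Γ : Type*} [Group Γ] {X : Subgroup (ℤ → Γ)}

/-- The subgroup of coordinates of homoclinic elements of a group shift. -/
def homoclinicCoord (X : Subgroup (ℤ → Γ)) : Subgroup Γ where
  carrier := {γ | ∃ x ∈ X, (∃ n : ℕ, ∀ j : ℤ, n < |j| → x j = 1) ∧ x 0 = γ}
  one_mem' := ⟨1, one_mem _, ⟨0, fun _ _ => rfl⟩, rfl⟩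
  mul_mem' := by
    rintro _ _ ⟨x, hx, ⟨m, hm⟩, rfl⟩ ⟨y, hy, ⟨n, hn⟩, rfl⟩
    refine ⟨x * y, mul_mem hx hy, ⟨max m n, fun j hj => ?_⟩, rfl⟩
    push_cast at hj
    simp [hm j (lt_of_le_of_lt (le_max_left _ _) hj), hn j (lt_of_le_of_lt (le_max_right _ _) hj)]
  inv_mem' := by
    rintro _ ⟨x, hx, ⟨m, hm⟩, rfl⟩
    exact ⟨x⁻¹, inv_mem hx, ⟨m, fun j hj => by simp [hm j hj]⟩, rfl⟩

theorem apply_mem_homoclinicCoord (hX : IsGroupShift X) {x : ℤ → Γ} (hx : x ∈ X) {a b : ℤ}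
    (ha : ∀ j < a, x j = 1) (hb : ∀ j, b ≤ j → x j = 1) (i : ℤ) :
    x i ∈ homoclinicCoord X := by
  refine ⟨_, hX.shift_mem i x hx, ⟨a.natAbs + b.natAbs + i.natAbs, fun j hj => ?_⟩, by simp⟩
  rcases lt_or_ge (j + i) a with h | h
  · exact ha _ h
  · refine hb _ ?_
    push_cast at hj
    rcases abs_cases j with h' | h' <;> rcases abs_cases a with h'' | h'' <;>
      rcases abs_cases b with h₃ | h₃ <;> rcases abs_cases i with h₄ | h₄ <;> omega

variable [Finite Γ]

/-- Compactness of a group shift, for coordinatewise conditions. -/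
theorem exists_mem_forall (hX : IsGroupShift X) (c : ℤ → Γ → Prop)
    (h : ∀ n : ℕ, ∃ x ∈ X, ∀ j : ℤ, |j| ≤ n → c j (x j)) : ∃ x ∈ X, ∀ j, c j (x j) := by
  let : TopologicalSpace Γ := ⊥
  have : DiscreteTopology Γ := ⟨rfl⟩
  have hopen (j : ℤ) (s : Set Γ) : IsClosed {x : ℤ → Γ | x j ∈ s} :=
    (isClosed_discrete s).preimage (continuous_apply j)
  have hclosed : IsClosed (X : Set (ℤ → Γ)) := by
    rw [← isOpen_compl_iff, isOpen_iff_mem_nhds]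
    intro x hx
    have : ¬ ∀ n : ℕ, ∃ y ∈ X, ∀ j : ℤ, |j| ≤ n → y j = x j := fun H =>
      hx (hX.mem_of_window x H)
    push Not at this
    obtain ⟨n, hn⟩ := this
    have hfin : (Set.Icc (-(n : ℤ)) n).Finite := Set.finite_Icc _ _
    have hmem : (⋂ j ∈ Set.Icc (-(n : ℤ)) n, {y : ℤ → Γ | y j = x j}) ∈ nhds x := by
      refine (Filter.biInter_mem hfin).2 fun j _ => ?_
      have : IsOpen {y : ℤ → Γ | y j ∈ ({x j} : Set Γ)} :=
        (isOpen_discrete _).preimage (continuous_apply j)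
      exact this.mem_nhds rfl
    refine Filter.mem_of_superset hmem fun y hy hyX => ?_
    obtain ⟨j, hj, hne⟩ := hn y hyX
    simp only [Set.mem_iInter] at hy
    exact hne (hy j (Set.mem_Icc.2 (abs_le.1 hj)))
  let t : ℕ → Set (ℤ → Γ) := fun n => {x | x ∈ X ∧ ∀ j : ℤ, |j| ≤ n → c j (x j)}
  have htc (n : ℕ) : IsClosed (t n) := by
    have : t n = (X : Set (ℤ → Γ)) ∩ ⋂ (j : ℤ) (_ : |j| ≤ n), {x | x j ∈ {γ | c j γ}} := by
      ext x; simp [t]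
    rw [this]
    exact hclosed.inter (isClosed_iInter fun j => isClosed_iInter fun _ => hopen j _)
  obtain ⟨x, hx⟩ := IsCompact.nonempty_iInter_of_sequence_nonempty_isCompact_isClosed t
    (fun n x hx => ⟨hx.1, fun j hj => hx.2 j (hj.trans (by push_cast; linarith))⟩)
    (fun n => by obtain ⟨x, hx, h⟩ := h n; exact ⟨x, hx, h⟩) (htc 0).isCompact htc
  simp only [Set.mem_iInter] at hx
  exact ⟨x, (hx 0).1, fun j => (hx j.natAbs).2 j (by simp)⟩

/-- Truncation: an element that is trivial on a long enough window splits at that window. -/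
theorem exists_truncate (hX : IsGroupShift X) : ∃ M : ℕ, ∀ (a : ℤ), ∀ x ∈ X,
    (∀ j, a - M ≤ j → j < a → x j = 1) →
      ∃ y ∈ X, (∀ j < a, y j = 1) ∧ ∀ j, a ≤ j → y j = x j := by
  -- The possible values at `0` after `n` trivial places form a decreasing chain of subsets of a
  -- finite set, so it stabilizes.
  let K : ℕ →o (Set Γ)ᵒᵈ := ⟨fun n => OrderDual.toDual
    {γ | ∃ x ∈ X, (∀ j : ℤ, -(n : ℤ) ≤ j → j < 0 → x j = 1) ∧ x 0 = γ}, by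
      rintro m n hmn γ ⟨x, hx, h1, h2⟩
      exact ⟨x, hx, fun j hj => h1 j (by omega), h2⟩⟩
  obtain ⟨M, hM⟩ := WellFoundedGT.monotone_chain_condition K
  -- By compactness a value that can follow arbitrarily long trivial windows can follow an infinite
  -- trivial past.
  have hK (γ : Γ) (hγ : γ ∈ OrderDual.ofDual (K M)) :
      ∃ x ∈ X, (∀ j < 0, x j = 1) ∧ x 0 = γ := by
    obtain ⟨x, hx, h⟩ := hX.exists_mem_forall
      (fun j δ => (j < 0 → δ = 1) ∧ (j = 0 → δ = γ)) fun n => by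
        have : γ ∈ OrderDual.ofDual (K (max M n)) := by
          rw [← hM _ (le_max_left M n)]; exact hγ
        obtain ⟨x, hx, h1, h2⟩ := this
        refine ⟨x, hx, fun j hj => ⟨fun hj0 => h1 j ?_ hj0, by rintro rfl; exact h2⟩⟩
        have := (abs_le.1 hj).1
        push_cast
        omega
    exact ⟨x, hx, fun j => (h j).1, (h 0).2 rfl⟩
  refine ⟨M, fun a x hx hxa => ?_⟩
  -- Built one place at a time: `y⁻¹ * x` is trivial on the `M` places before `a + n`, so its value
  -- there is that of an element trivial further left, which corrects `y`.
  have key (n : ℕ) : ∃ y ∈ X, (∀ j < a, y j = 1) ∧ ∀ j, a ≤ j → j < a + n → y j = x j := by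
    induction n with
    | zero => exact ⟨1, one_mem _, fun _ _ => rfl, fun j h1 h2 => by omega⟩
    | succ n ih =>
      obtain ⟨y, hy, hy1, hy2⟩ := ih
      have hw := hX.shift_mem (a + n) _ (mul_mem (inv_mem hy) hx)
      obtain ⟨v, hv, hv1, hv0⟩ := hK ((y⁻¹ * x) (a + n)) ⟨_, hw, fun j hj1 hj2 => by
        by_cases hja : j + (a + n) < a
        · simp [hy1 _ hja, hxa _ (by omega) hja]
        · simp [hy2 (j + (a + n)) (by omega) (by omega)], by simp⟩
      refine ⟨_, mul_mem hy (hX.shift_mem (-(a + n)) _ hv), fun j hj => ?_, fun j hj1 hj2 => ?_⟩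
      · simp only [Pi.mul_apply, hy1 j hj, hv1 (j + -(a + n)) (by omega), mul_one]
      · rcases lt_or_eq_of_le (show j ≤ a + n by push_cast at hj2; omega) with h | rfl
        · have := hv1 (j + -(a + n)) (by omega)
          simp only [Pi.mul_apply, this, mul_one]
          exact hy2 j hj1 h
        · simp [hv0]
  obtain ⟨y, hy, h⟩ := hX.exists_mem_forall
    (fun j γ => (j < a → γ = 1) ∧ (a ≤ j → γ = x j)) fun n => by
      obtain ⟨y, hy, h1, h2⟩ := key (n + a.natAbs + 1)
      refine ⟨y, hy, fun j hj => ⟨h1 j, fun hja => h2 j hja ?_⟩⟩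
      have := (abs_le.1 hj).2
      push_cast
      have := abs_le.1 (le_refl |a|)
      omega
  exact ⟨y, hy, fun j => (h j).1, fun j => (h j).2⟩

/-- An element trivial to the left of some position can be returned to the identity. -/
theorem exists_return (hX : IsGroupShift X) : ∃ m : ℕ, ∀ (a b : ℤ), ∀ x ∈ X,
    (∀ j < a, x j = 1) → ∃ y ∈ X, (∀ j < b, y j = x j) ∧ ∀ j, b + m ≤ j → y j = 1 := by
  obtain ⟨M, hM⟩ := hX.exists_truncate
  -- Words of length `M` reachable from the identity within `n` steps: an increasing chain of
  -- subsets of a finite set. Once it is stable, every reachable word is reachable within `m` steps.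
  let F : ℕ →o Set (Fin M → Γ) := ⟨fun n =>
    {w | ∃ x ∈ X, (∀ j : ℤ, j < -(n : ℤ) → x j = 1) ∧ ∀ t : Fin M, x (t : ℕ) = w t}, by
      rintro m n hmn w ⟨x, hx, h1, h2⟩
      exact ⟨x, hx, fun j hj => h1 j (by omega), h2⟩⟩
  obtain ⟨m, hm⟩ := WellFoundedGT.monotone_chain_condition F
  refine ⟨m, fun a b x hx hxa => ?_⟩
  have hF : (fun t : Fin M => x ((t : ℕ) + (b + m))) ∈ F m := by
    rw [hm (max m (b + m - a).natAbs) (le_max_left _ _)]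
    refine ⟨_, hX.shift_mem (b + m) x hx, fun j hj => hxa _ ?_, fun t => rfl⟩
    push_cast at hj
    have := le_abs_self (b + m - a)
    have := le_max_right (m : ℤ) |b + m - a|
    omega
  obtain ⟨x', hx', h1, h2⟩ := hF
  -- The translate of `x'` leaves the identity only from `b` on and shows the same word as `x` at `b
  -- + m`. The quotient is therefore trivial on a window, and dividing by its truncation removes
  -- everything to the right.
  have hw := mul_mem (inv_mem (hX.shift_mem (-(b + m)) _ hx')) hx
  obtain ⟨y, hy, hy1, hy2⟩ := hM (b + m + M) _ hw fun j hj1 hj2 => by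
    have := h2 ⟨(j - (b + m)).toNat, by omega⟩
    have e : (((j - (b + m)).toNat : ℕ) : ℤ) = j - (b + m) := Int.toNat_of_nonneg (by omega)
    simp only [e, sub_add_cancel] at this
    simp [← this, sub_eq_add_neg]
  refine ⟨_, mul_mem hw (inv_mem hy), fun j hj => ?_, fun j hj => ?_⟩
  · simp only [Pi.mul_apply, Pi.inv_apply, h1 (j + -(b + m)) (by omega), hy1 j (by omega), inv_one,
      one_mul, mul_one]
  · rcases lt_or_ge j (b + m + M) with h | h
    · have := h2 ⟨(j - (b + m)).toNat, by omega⟩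
      have e : (((j - (b + m)).toNat : ℕ) : ℤ) = j - (b + m) := Int.toNat_of_nonneg (by omega)
      simp only [e, sub_add_cancel] at this
      simp [← this, sub_eq_add_neg, hy1 j h]
    · simp [hy2 j h]

/-- Truncating at `0` kills the left side, and returning to the identity after place `j` kills the
right side. Neither changes the value at `j`, which thus belongs to a finitely supported element. -/
theorem exists_window_right (hX : IsGroupShift X) : ∃ M : ℕ, ∀ x ∈ X,
    (∀ j : ℤ, |j| ≤ M → x j = 1) → ∀ j, 0 ≤ j → x j ∈ homoclinicCoord X := by
  obtain ⟨M, hM⟩ := hX.exists_truncate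
  obtain ⟨m, hm⟩ := hX.exists_return
  refine ⟨M, fun x hx h j hj => ?_⟩
  obtain ⟨y, hy, hy1, hy2⟩ := hM 0 x hx fun i h1 h2 => h i (abs_le.2 ⟨by omega, by omega⟩)
  obtain ⟨z, hz, hz1, hz2⟩ := hm 0 (j + 1) y hy hy1
  rw [← hy2 j hj, ← hz1 j (by omega)]
  refine hX.apply_mem_homoclinicCoord hz (a := 0) (fun i hi => ?_) hz2 j
  rw [hz1 i (by omega), hy1 i hi]

/-- Elements trivial on a large window have all their coordinates in the homoclinic subgroup. -/
theorem exists_window (hX : IsGroupShift X) : ∃ M : ℕ, ∀ x ∈ X,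
    (∀ j : ℤ, |j| ≤ M → x j = 1) → ∀ j, x j ∈ homoclinicCoord X := by
  obtain ⟨M, hM⟩ := hX.exists_window_right
  obtain ⟨M', hM'⟩ := hX.reflect.exists_window_right
  refine ⟨max M M', fun x hx h j => ?_⟩
  rcases le_total 0 j with hj | hj
  · exact hM x hx (fun i hi => h i (hi.trans (by simp))) j hj
  · have hx' : (fun i => x (-i)) ∈
        X.comap (reflectHom Γ) := by
      refine (congrArg (· ∈ X) (funext fun i => ?_)).mp hx
      simp [reflectHom]
    obtain ⟨y, hy, ⟨n, hn⟩, hy0⟩ := hM' _ hx'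
      (fun i hi => h (-i) (by rw [abs_neg]; exact hi.trans (by simp))) (-j) (by omega)
    rw [neg_neg] at hy0
    rw [← hy0]
    refine ⟨_, hy, ⟨n, fun i hi => ?_⟩, rfl⟩
    exact (hn (-i) (by simpa using hi))

/-- Along a sparse progression, homoclinic coordinates can be prescribed arbitrarily. -/
theorem exists_prescribed (hX : IsGroupShift X) : ∃ n : ℕ, ∀ ℓ : ℤ, n < ℓ →
    ∀ ν : ℤ → Γ, (∀ t, ν t ∈ homoclinicCoord X) → ∃ x ∈ X, ∀ t, x (ℓ * t) = ν t := by
  have hex (γ : homoclinicCoord X) : ∃ x ∈ X, (∃ n : ℕ, ∀ j : ℤ, n < |j| → x j = 1) ∧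
    x 0 = γ := γ.2
  choose u hu hn hu0 using hex
  choose n hn using hn
  -- A common bound for the supports of one chosen element per homoclinic value: translates by
  -- multiples of `ℓ > N` then do not interfere along `ℓℤ`, and products of them realize finite
  -- prescriptions.
  obtain ⟨N, hN⟩ := (Set.finite_range n).bddAbove
  refine ⟨N, fun ℓ hℓ ν hν => ?_⟩
  have hsep (γ) (t : ℤ) (ht : t ≠ 0) : u γ (ℓ * t) = 1 := by
    refine hn γ _ ?_
    have h1 : (n γ : ℤ) ≤ N := by exact_mod_cast hN ⟨γ, rfl⟩
    rw [abs_mul]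
    have h2 : 1 ≤ |t| := Int.one_le_abs ht
    have h3 : ℓ ≤ |ℓ| := le_abs_self ℓ
    nlinarith [abs_nonneg ℓ]
  have key (J : Finset ℤ) : ∃ x ∈ X, (∀ t ∈ J, x (ℓ * t) = ν t) ∧ ∀ t ∉ J, x (ℓ * t) = 1 := by
    induction J using Finset.induction_on with
    | empty => exact ⟨1, one_mem _, by simp, by simp⟩
    | insert s J hs ih =>
      obtain ⟨x, hx, h1, h2⟩ := ih
      have hv := hX.shift_mem (-(ℓ * s)) _ (hu ⟨ν s, hν s⟩)
      have hv1 (t : ℤ) (ht : t ≠ s) : u ⟨ν s, hν s⟩ (ℓ * t + -(ℓ * s)) = 1 := by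
        rw [← mul_neg, ← mul_add]
        exact hsep _ _ (by omega)
      refine ⟨_, mul_mem hx hv, fun t ht => ?_, fun t ht => ?_⟩
      · rcases Finset.mem_insert.1 ht with rfl | htJ
        · simp [h2 t hs, hu0]
        · have : t ≠ s := fun h => hs (h ▸ htJ)
          simp [h1 t htJ, hv1 t this]
      · rw [Finset.mem_insert, not_or] at ht
        simp [h2 t ht.2, hv1 t ht.1]
  obtain ⟨x, hx, h⟩ := hX.exists_mem_forall (fun j γ => ∀ t, j = ℓ * t → γ = ν t) fun m => by
    obtain ⟨x, hx, h, -⟩ := key (Finset.Icc (-m : ℤ) m)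
    refine ⟨x, hx, fun j hj t hjt => ?_⟩
    subst hjt
    refine h t (Finset.mem_Icc.2 (abs_le.1 (le_trans ?_ hj)))
    rw [abs_mul]
    have h3 : ℓ ≤ |ℓ| := le_abs_self ℓ
    have : (0 : ℤ) ≤ N := by positivity
    nlinarith [abs_nonneg t]
  exact ⟨x, hx, fun t => h _ t rfl⟩

end IsGroupShift

/-! ### Automorphisms acting on the translates of a finite set -/

theorem IsDifferenceExt.zpow {A B : Type*} [CommRing A] [CommRing B] [Algebra A B]
    {σ : A ≃+* A} {τ : B ≃+* B} (h : IsDifferenceExt σ τ) (j : ℤ) :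
    IsDifferenceExt (σ ^ j) (τ ^ j) := by
  induction j with
  | zero => exact fun _ => rfl
  | succ n ih =>
    intro x
    rw [zpow_add_one, zpow_add_one, RingAut.mul_apply, RingAut.mul_apply, h, ih]
  | pred n ih =>
    intro x
    rw [zpow_sub_one, zpow_sub_one, RingAut.mul_apply, RingAut.mul_apply]
    exact (congrArg _ (h.symm x)).trans (ih _)

theorem RingEquiv.zpow_add_apply {B : Type*} [CommRing B] (τ : B ≃+* B) (i j : ℤ) (x : B) :
    (τ ^ (i + j)) x = (τ ^ i) ((τ ^ j) x) := by
  rw [zpow_add]; rfl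

section Conj

variable {A B : Type*} [CommRing A] [CommRing B] [Algebra A B] {σ : A ≃+* A} {τ : B ≃+* B}

/-- The conjugate `τ⁻ʲ g τʲ` of an `A`-automorphism by a power of a semilinear automorphism. -/
def conjZPow (hτ : IsDifferenceExt σ τ) (j : ℤ) (g : B ≃ₐ[A] B) : B ≃ₐ[A] B :=
  AlgEquiv.ofRingEquiv (f := (τ ^ j).trans (g.toRingEquiv.trans (τ ^ (-j)))) fun a => by
    have h1 := hτ.zpow j a
    have h2 := hτ.zpow (-j) ((σ ^ j) a)
    simp only [RingEquiv.trans_apply]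
    rw [h1]
    refine (congrArg _ (g.commutes _)).trans ?_
    rw [h2, ← RingEquiv.zpow_add_apply, neg_add_cancel, zpow_zero]
    rfl

theorem conjZPow_apply (hτ : IsDifferenceExt σ τ) (j : ℤ) (g : B ≃ₐ[A] B) (y : B) :
    conjZPow hτ j g y = (τ ^ (-j)) (g ((τ ^ j) y)) := rfl

theorem zpow_conjZPow_apply (hτ : IsDifferenceExt σ τ) (j : ℤ) (g : B ≃ₐ[A] B) (y : B) :
    (τ ^ j) (conjZPow hτ j g y) = g ((τ ^ j) y) := by
  rw [conjZPow_apply, ← RingEquiv.zpow_add_apply, add_neg_cancel, zpow_zero]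
  rfl

theorem conjZPow_mul (hτ : IsDifferenceExt σ τ) (j : ℤ) (g h : B ≃ₐ[A] B) :
    conjZPow hτ j (g * h) = conjZPow hτ j g * conjZPow hτ j h := by
  ext y
  apply (τ ^ j).injective
  rw [AlgEquiv.mul_apply, zpow_conjZPow_apply, zpow_conjZPow_apply, zpow_conjZPow_apply]
  rfl

theorem conjZPow_add (hτ : IsDifferenceExt σ τ) (i j : ℤ) (g : B ≃ₐ[A] B) :
    conjZPow hτ (i + j) g = conjZPow hτ i (conjZPow hτ j g) := by
  ext y
  rw [conjZPow_apply, conjZPow_apply, conjZPow_apply, ← RingEquiv.zpow_add_apply,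
    ← RingEquiv.zpow_add_apply, neg_add, add_comm j i]

variable {Y : Finset B} (hY : ∀ g : B ≃ₐ[A] B, ∀ y ∈ Y, g y ∈ Y)

/-- The permutation of a stable finite set induced by an automorphism. -/
def permOn : (B ≃ₐ[A] B) →* Equiv.Perm Y where
  toFun g := ⟨fun y => ⟨g y, hY g y y.2⟩, fun y => ⟨g⁻¹ y, hY g⁻¹ y y.2⟩,
    fun _ => Subtype.ext (g.symm_apply_apply _), fun _ => Subtype.ext (g.apply_symm_apply _)⟩
  map_one' := rfl
  map_mul' _ _ := rfl

/-- The family of permutations induced by an automorphism on the translates of a finite set. -/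
def permSeq (hτ : IsDifferenceExt σ τ) : (B ≃ₐ[A] B) →* (ℤ → Equiv.Perm Y) :=
  MonoidHom.mk' (fun g j => permOn hY (conjZPow hτ j g)) fun g h => by
    ext j : 1
    rw [conjZPow_mul, map_mul]
    rfl

theorem zpow_permSeq_apply (hτ : IsDifferenceExt σ τ) (g : B ≃ₐ[A] B) (j : ℤ) (y : Y) :
    (τ ^ j) (permSeq hY hτ g j y) = g ((τ ^ j) y) :=
  zpow_conjZPow_apply hτ j g y

/-- The closure of the group of families of permutations induced by automorphisms. -/
def permShift (hτ : IsDifferenceExt σ τ) : Subgroup (ℤ → Equiv.Perm Y) where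
  carrier := {x | ∀ n : ℕ, ∃ g : B ≃ₐ[A] B, ∀ j : ℤ, |j| ≤ n → permSeq hY hτ g j = x j}
  one_mem' n := ⟨1, fun j _ => by rw [map_one]⟩
  mul_mem' {x y} hx hy n := by
    obtain ⟨g, hg⟩ := hx n
    obtain ⟨h, hh⟩ := hy n
    exact ⟨g * h, fun j hj => by rw [map_mul, Pi.mul_apply, hg j hj, hh j hj, Pi.mul_apply]⟩
  inv_mem' {x} hx n := by
    obtain ⟨g, hg⟩ := hx n
    exact ⟨g⁻¹, fun j hj => by rw [map_inv, Pi.inv_apply, hg j hj, Pi.inv_apply]⟩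

theorem permSeq_mem_permShift (hτ : IsDifferenceExt σ τ) (g : B ≃ₐ[A] B) :
    permSeq hY hτ g ∈ permShift hY hτ :=
  fun _ => ⟨g, fun _ _ => rfl⟩

/-- Closedness is built into the definition by finite windows. Shift invariance holds because
conjugating an automorphism by `τ ^ k` translates its family of permutations by `k`. -/
theorem isGroupShift_permShift (hτ : IsDifferenceExt σ τ) : IsGroupShift (permShift hY hτ) where
  mem_of_window x h n := by
    obtain ⟨y, hy, hxy⟩ := h n
    obtain ⟨g, hg⟩ := hy n
    exact ⟨g, fun j hj => (hg j hj).trans (hxy j hj)⟩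
  shift_mem k x hx n := by
    obtain ⟨g, hg⟩ := hx (n + k.natAbs)
    refine ⟨conjZPow hτ k g, fun j hj => ?_⟩
    refine Eq.trans ?_ (hg (j + k) ((abs_add_le j k).trans (by push_cast; gcongr)))
    exact congrArg (permOn hY) (conjZPow_add hτ j k g).symm

/-- If the automorphisms of `B` over `A` act transitively on the homomorphisms to `Λ` over `A`,
then a homomorphism `φ` can be made periodic on a finite stable set `Y` along a progression. -/
theorem exists_periodic {Λ : Type*} [CommRing Λ] [Algebra A Λ] {ρ : Λ ≃+* Λ}
    {Y : Finset B} (hY : ∀ g : B ≃ₐ[A] B, ∀ y ∈ Y, g y ∈ Y)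
    (hτ : IsDifferenceExt σ τ) (hρ : IsDifferenceExt σ ρ)
    (htrans : ∀ (φ φ' : B →ₐ[A] Λ) (s : Finset B), ∃ g : B ≃ₐ[A] B, ∀ b ∈ s, φ' b = φ (g b))
    (φ : B →ₐ[A] Λ) :
    ∃ ℓ : ℕ, 1 ≤ ℓ ∧ ∀ J : Finset ℤ, ∃ g : B ≃ₐ[A] B, ∀ t ∈ J, ∀ y ∈ Y,
      φ (g ((τ ^ (ℓ * t)) y)) = (ρ ^ (ℓ * t)) (φ y) := by
  classical
  have hX := isGroupShift_permShift hY hτ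
  let z : ℤ → Y → Λ := fun j y => (ρ ^ (-j)) (φ ((τ ^ j) y))
  have hz (k : ℤ) : ∃ x ∈ permShift hY hτ, ∀ j, ∀ y, z (j + k) y = z j (x j y) := by
    refine hX.exists_mem_forall (fun j γ => ∀ y, z (j + k) y = z j (γ y)) fun n => ?_
    -- The twist `ρ^{-k} φ τ^k` is again `A`-linear, so by transitivity it is `φ ∘ g` on the
    -- finitely many translates in a window.
    let φ' : B →ₐ[A] Λ :=
      { toRingHom := ((ρ ^ (-k) : Λ ≃+* Λ) : Λ →+* Λ).comp
          ((φ : B →+* Λ).comp ((τ ^ k : B ≃+* B) : B →+* B))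
        commutes' := fun a => by
          have h1 := hτ.zpow k a
          have h2 := hρ.zpow (-k) ((σ ^ k) a)
          change (ρ ^ (-k)) (φ ((τ ^ k) (algebraMap A B a))) = _
          rw [h1, φ.commutes, h2, ← RingEquiv.zpow_add_apply, neg_add_cancel, zpow_zero]
          rfl }
    obtain ⟨g, hg⟩ := htrans φ φ' ((Finset.Icc (-n : ℤ) n).biUnion fun j => Y.image (τ ^ j))
    refine ⟨_, permSeq_mem_permShift hY hτ g, fun j hj y => ?_⟩
    have h := hg ((τ ^ j) y) (Finset.mem_biUnion.2
      ⟨j, Finset.mem_Icc.2 (abs_le.1 hj), Finset.mem_image_of_mem _ y.2⟩)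
    change (ρ ^ (-(j + k))) (φ ((τ ^ (j + k)) y)) = (ρ ^ (-j)) (φ ((τ ^ j) _))
    rw [zpow_permSeq_apply, ← h, neg_add, RingEquiv.zpow_add_apply, add_comm j k,
      RingEquiv.zpow_add_apply]
    rfl
  choose x hx hxz using hz
  obtain ⟨M, hM⟩ := hX.exists_window
  obtain ⟨n, hn⟩ := hX.exists_prescribed
  -- Pigeonhole on the restrictions to the window. Only shifts by multiples of `n + 1` are compared,
  -- so that their difference `ℓ` exceeds `n`.
  obtain ⟨i, i', hne, heq⟩ := Finite.exists_ne_map_eq_of_infinite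
    fun (i : ℕ) (j : Set.Icc (-M : ℤ) M) => x ((n + 1) * i) j
  wlog hlt : i < i' generalizing i i'
  · exact this i' i hne.symm heq.symm (lt_of_le_of_ne (not_lt.1 hlt) hne.symm)
  obtain ⟨ℓ, hℓ⟩ : ∃ ℓ : ℕ, ℓ = (n + 1) * (i' - i) := ⟨_, rfl⟩
  have hℓn : n < ℓ := by
    rw [hℓ]
    exact lt_of_lt_of_le (Nat.lt_succ_self n) (Nat.le_mul_of_pos_right _ (by omega))
  have hℓi : ((n + 1 : ℤ) * i') = (n + 1) * i + ℓ := by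
    rw [hℓ]; push_cast [hlt.le]; ring
  -- translates by `ℓ` differ by elements with homoclinic coordinates
  have hstep (j : ℤ) : ∃ γ ∈ IsGroupShift.homoclinicCoord (permShift hY hτ),
      ∀ y, z (j + ℓ) y = z j (γ y) := by
    refine ⟨_, hM _ (mul_mem (inv_mem (hx ((n + 1) * i))) (hx ((n + 1) * i')))
      (fun j hj => ?_) (j - (n + 1) * i), fun y => ?_⟩
    · have := congrFun heq ⟨j, Set.mem_Icc.2 (abs_le.1 hj)⟩
      simp only at this
      simp [this]
    · have h1 := hxz ((n + 1) * i') (j - (n + 1) * i) y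
      have h2 := fun y => hxz ((n + 1) * i) (j - (n + 1) * i) y
      rw [sub_add_cancel] at h2
      rw [hℓi, ← add_assoc, sub_add_cancel] at h1
      rw [h2, h1]
      simp [hℓi]
  -- The steps telescope inside the homoclinic group, since it is closed under products and
  -- inverses.
  have hper (t : ℤ) : ∃ γ ∈ IsGroupShift.homoclinicCoord (permShift hY hτ),
      ∀ y, z (ℓ * t) y = z 0 (γ y) := by
    induction t with
    | zero => exact ⟨1, one_mem _, fun y => by simp⟩
    | succ t ih =>
      obtain ⟨γ, hγ, h⟩ := ih
      obtain ⟨δ, hδ, h'⟩ := hstep (ℓ * t)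
      refine ⟨γ * δ, mul_mem hγ hδ, fun y => ?_⟩
      rw [mul_add, mul_one, h', h]
      rfl
    | pred t ih =>
      obtain ⟨γ, hγ, h⟩ := ih
      obtain ⟨δ, hδ, h'⟩ := hstep (ℓ * (-t - 1))
      refine ⟨γ * δ⁻¹, mul_mem hγ (inv_mem hδ), fun y => ?_⟩
      have := h' (δ⁻¹ y)
      rw [show δ (δ⁻¹ y) = y from δ.apply_symm_apply y,
        show (ℓ : ℤ) * (-t - 1) + ℓ = ℓ * -t by ring, h] at this
      rw [← this]
      rfl
  choose μ hμ hμz using hper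
  -- The element `u` cancels the defect `μ t` at every place `ℓ * t`; an automorphism agreeing with
  -- `u` on a window containing all `ℓ * t`, `t ∈ J`, is the required `g`.
  obtain ⟨u, hu, huμ⟩ := hn ℓ (by exact_mod_cast hℓn) (fun t => (μ t)⁻¹) fun t => inv_mem (hμ t)
  refine ⟨ℓ, by omega, fun J => ?_⟩
  obtain ⟨N, hN⟩ : ∃ N : ℕ, ∀ t ∈ J, |ℓ * t| ≤ N := by
    refine ⟨∑ t ∈ J, |ℓ * t|.natAbs, fun t ht => ?_⟩
    have := Finset.single_le_sum (f := fun t : ℤ => |ℓ * t|.natAbs) (fun _ _ => Nat.zero_le _) ht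
    have h2 : ((|ℓ * t|.natAbs : ℕ) : ℤ) = |ℓ * t| := by simp
    rw [← h2]
    exact_mod_cast this
  obtain ⟨g, hg⟩ := hu N
  refine ⟨g, fun t ht y hy => ?_⟩
  have h1 := zpow_permSeq_apply hY hτ g (ℓ * t) ⟨y, hy⟩
  rw [hg _ (hN t ht), huμ] at h1
  have h2 := hμz t ((μ t)⁻¹ ⟨y, hy⟩)
  rw [show μ t ((μ t)⁻¹ ⟨y, hy⟩) = ⟨y, hy⟩ from (μ t).apply_symm_apply _] at h2
  have h3 : (ρ ^ (-(ℓ * t))) (φ (g ((τ ^ (ℓ * t)) y))) = φ y := by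
    rw [← h1]
    exact h2.trans rfl
  rw [← h3, ← RingEquiv.zpow_add_apply, add_neg_cancel, zpow_zero]
  rfl

end Conj

/-! ### Transitivity of automorphisms on homomorphisms from an integral closure -/

section IntegralClosure

open Polynomial

/-- A finite set of elements lies in one that is stable under automorphisms. -/
theorem exists_finset_stable {A : Type*} (B : Type*) [CommRing A] [CommRing B]
    [IsDomain B] [Algebra A B] [Algebra.IsIntegral A B] (s : Finset B) :
    ∃ Y : Finset B, s ⊆ Y ∧ ∀ g : B ≃ₐ[A] B, ∀ y ∈ Y, g y ∈ Y := by
  classical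
  -- Automorphisms over `A` permute the roots in `B` of each minimal polynomial.
  refine ⟨s.biUnion fun b => ((minpoly A b).map (algebraMap A B)).roots.toFinset,
    fun b hb => ?_, fun g y hy => ?_⟩
  · refine Finset.mem_biUnion.2 ⟨b, hb, ?_⟩
    rw [Multiset.mem_toFinset, mem_roots ((minpoly.monic (Algebra.IsIntegral.isIntegral b)).map
      _).ne_zero, IsRoot.def, eval_map_algebraMap, minpoly.aeval]
  · obtain ⟨b, hb, hy⟩ := Finset.mem_biUnion.1 hy
    refine Finset.mem_biUnion.2 ⟨b, hb, ?_⟩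
    have h0 := ((minpoly.monic (Algebra.IsIntegral.isIntegral (R := A) b)).map
      (algebraMap A B)).ne_zero
    rw [Multiset.mem_toFinset, mem_roots h0, IsRoot.def, eval_map_algebraMap] at hy ⊢
    rw [show g y = (g : B →ₐ[A] B) y from rfl, aeval_algHom_apply, hy, map_zero]

variable {A Ω : Type*} [CommRing A] [IsDomain A] [IsIntegrallyClosed A] [Field Ω] [IsAlgClosed Ω]
  [Algebra A Ω] [FaithfulSMul A Ω] [Algebra.IsAlgebraic A Ω]

/-- Normality makes the minimal polynomial over `A` that over the fraction field, where conjugate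
elements of a normal extension are related by an automorphism. -/
theorem exists_algEquiv_apply_eq {u v : Ω} (hu : IsIntegral A u)
    (hv : aeval v (minpoly A u) = 0) : ∃ g : Ω ≃ₐ[A] Ω, g u = v := by
  let L := FractionRing A
  let : Algebra L Ω := FractionRing.liftAlgebra A Ω
  have : IsScalarTower A L Ω := FractionRing.isScalarTower_liftAlgebra A Ω
  have : Algebra.IsAlgebraic L Ω := (IsFractionRing.comap_isAlgebraic_iff (A := A)).1 inferInstance
  have : IsAlgClosure L Ω := ⟨inferInstance, inferInstance⟩
  have : Normal L Ω := IsAlgClosure.normal L Ω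
  have hv' : aeval v (minpoly L u) = 0 := by
    rw [minpoly.isIntegrallyClosed_eq_field_fractions' L hu, aeval_map_algebraMap]
    exact hv
  obtain ⟨g, hg⟩ := minpoly.exists_algEquiv_of_root' (Algebra.IsAlgebraic.isAlgebraic u) hv'
  exact ⟨g.restrictScalars A, hg⟩

variable {Λ : Type*} [CommRing Λ] [IsDomain Λ] [Algebra A Λ]

/-- The minimal polynomial of `u` splits into linear factors over the integral closure. Applying `φ`
to this factorization shows that its root `φ' u` in the domain `Λ` is `φ b` for some root `b`, and
`b` is conjugate to `u`. -/
theorem exists_algEquiv_comp_apply (φ φ' : integralClosure A Ω →ₐ[A] Λ) (u : integralClosure A Ω) :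
    ∃ g : integralClosure A Ω ≃ₐ[A] integralClosure A Ω, φ' u = φ (g u) := by
  have hu : IsIntegral A (u : Ω) := u.2
  have hmonic := minpoly.monic hu
  have hroots : ∀ w ∈ ((minpoly A (u : Ω)).map (algebraMap A Ω)).roots,
      w ∈ integralClosure A Ω := by
    intro w hw
    have h0 := (mem_roots'.1 hw).2
    rw [IsRoot.def, eval_map] at h0
    exact ⟨_, hmonic, h0⟩
  obtain ⟨m, hm⟩ : ∃ m : Multiset (integralClosure A Ω),
      m.map (↑) = ((minpoly A (u : Ω)).map (algebraMap A Ω)).roots := by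
    lift ((minpoly A (u : Ω)).map (algebraMap A Ω)).roots to Multiset (integralClosure A Ω)
      using hroots with m
    exact ⟨m, rfl⟩
  have hprod : (minpoly A (u : Ω)).map (algebraMap A (integralClosure A Ω)) =
      (m.map fun b => X - C b).prod := by
    apply map_injective (algebraMap (integralClosure A Ω) Ω) Subtype.val_injective
    rw [Polynomial.map_map, ← IsScalarTower.algebraMap_eq,
      (IsAlgClosed.splits _).eq_prod_roots_of_monic (hmonic.map _), ← hm,
      Polynomial.map_multiset_prod,
      Multiset.map_map, Multiset.map_map]
    congr 1
    refine Multiset.map_congr rfl fun b _ => ?_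
    simp only [Function.comp_apply, Polynomial.map_sub, map_X, map_C]
    rfl
  have h0 : aeval (φ' u) (minpoly A (u : Ω)) = 0 := by
    rw [aeval_algHom_apply]
    have : aeval u (minpoly A (u : Ω)) = 0 := by
      apply Subtype.val_injective
      have := minpoly.aeval A (u : Ω)
      rw [show (u : Ω) = (integralClosure A Ω).val u from rfl, aeval_algHom_apply] at this
      exact this
    rw [this, map_zero]
  have h1 : ((m.map fun b => φ' u - φ b)).prod = 0 := by
    have h2 : (minpoly A (u : Ω)).map (algebraMap A Λ) = (m.map fun b => X - C (φ b)).prod := by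
      rw [← φ.comp_algebraMap, ← Polynomial.map_map, hprod, Polynomial.map_multiset_prod,
        Multiset.map_map]
      congr 1
      refine Multiset.map_congr rfl fun b _ => ?_
      simp
    rw [← eval_map_algebraMap, h2, eval_multiset_prod, Multiset.map_map] at h0
    simpa using h0
  rw [Multiset.prod_eq_zero_iff, Multiset.mem_map] at h1
  obtain ⟨b, hb, hb0⟩ := h1
  have hbroot : (b : Ω) ∈ ((minpoly A (u : Ω)).map (algebraMap A Ω)).roots :=
    hm ▸ Multiset.mem_map_of_mem _ hb
  have := (mem_roots'.1 hbroot).2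
  rw [IsRoot.def, eval_map_algebraMap] at this
  obtain ⟨g, hg⟩ := exists_algEquiv_apply_eq hu this
  refine ⟨g.mapIntegralClosure, ?_⟩
  rw [sub_eq_zero.1 hb0]
  congr 1
  exact Subtype.ext hg.symm

/-- Over a normal domain containing an infinite field, the automorphisms of the absolute integral
closure act transitively on the homomorphisms to a domain, on every finite set. -/
theorem exists_algEquiv_comp_apply_finset {k : Type*} [Field k] [Infinite k] [Algebra k A]
    (φ φ' : integralClosure A Ω →ₐ[A] Λ) (s : Finset (integralClosure A Ω)) :
    ∃ g : integralClosure A Ω ≃ₐ[A] integralClosure A Ω, ∀ b ∈ s, φ' b = φ (g b) := by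
  classical
  obtain ⟨Y, hsY, hY⟩ := exists_finset_stable (A := A) (integralClosure A Ω) s
  let e := s.equivFin
  let i : k →+* A := algebraMap k A
  -- One element packs the whole finite set, with powers of a parameter `l` as coefficients. The
  -- automorphism for `u l` has finitely many possible restrictions to `s`, so one restriction `f`
  -- serves infinitely many `l`.
  let u : k → integralClosure A Ω := fun l => ∑ b : s, algebraMap A _ (i l ^ (e b : ℕ)) * b
  choose g hg using fun l => exists_algEquiv_comp_apply φ φ' (u l)
  obtain ⟨f, hf⟩ := Finite.exists_infinite_fiber
    fun (l : k) (b : s) => (⟨g l b, hY (g l) b (hsY b.2)⟩ : Y)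
  have hfib : {l : k | ∀ b : s, g l b = f b}.Infinite := by
    refine (Set.infinite_coe_iff.1 hf).mono fun l hl b => ?_
    rw [Set.mem_preimage, Set.mem_singleton_iff] at hl
    exact congrArg Subtype.val (congrFun hl b)
  let p : Λ[X] := ∑ b : s, C (φ' b - φ (f b)) * X ^ (e b : ℕ)
  have hinj : Function.Injective ((algebraMap A Λ).comp i) := RingHom.injective _
  -- Each `l` in the infinite fibre gives a root of `p`; the vanishing coefficients are the desired
  -- equalities.
  have hp : p = 0 := by
    refine eq_zero_of_infinite_isRoot p ((hfib.image hinj.injOn).mono ?_)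
    rintro _ ⟨l, hl, rfl⟩
    have h := hg l
    simp only [u, map_sum, map_mul, AlgEquiv.commutes, AlgHom.commutes] at h
    rw [← sub_eq_zero, ← Finset.sum_sub_distrib] at h
    rw [Set.mem_ofPred_eq, IsRoot.def, eval_finsetSum, ← h]
    refine Finset.sum_congr rfl fun b _ => ?_
    simp only [eval_mul, eval_C, eval_pow, eval_X, hl b, RingHom.comp_apply, map_pow]
    ring
  obtain ⟨l, hl⟩ := hfib.nonempty
  refine ⟨g l, fun b hb => ?_⟩
  have hcoeff := congrArg (fun q => coeff q (e ⟨b, hb⟩ : ℕ)) hp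
  simp only [p, finsetSum_coeff, coeff_C_mul, coeff_X_pow, coeff_zero] at hcoeff
  rw [Finset.sum_eq_single ⟨b, hb⟩] at hcoeff
  · rw [hl ⟨b, hb⟩]
    simpa [sub_eq_zero] using hcoeff
  · intro b' _ hne
    rw [if_neg, mul_zero]
    intro h
    exact hne (e.injective (Fin.ext h.symm))
  · simp

end IntegralClosure

/-! ### Extending prime σ-ideals over a normal difference domain -/

theorem isSigmaIdeal_iff {A : Type*} [CommRing A] {σ : A ≃+* A} {I : Ideal A} :
    IsSigmaIdeal σ I ↔ ∀ x, σ x ∈ I ↔ x ∈ I := by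
  have h1 : I.map σ = I.comap σ.symm := Ideal.map_comap_of_equiv σ
  rw [IsSigmaIdeal, h1]
  constructor
  · intro h x
    conv_lhs => rw [← h]
    rw [Ideal.mem_comap]
    simp
  · intro h
    ext x
    rw [Ideal.mem_comap, ← h]
    simp

section Extend

variable {A B : Type*} [CommRing A] [CommRing B] [Algebra A B] {σ : A ≃+* A} {τ : B ≃+* B}

theorem IsDifferenceExt.isIntegral_apply (h : IsDifferenceExt σ τ) {x : B} (hx : IsIntegral A x) :
    IsIntegral A (τ x) := by
  obtain ⟨p, hp, hx⟩ := hx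
  refine ⟨p.map (σ : A →+* A), hp.map _, ?_⟩
  rw [Polynomial.eval₂_map, show (algebraMap A B).comp (σ : A →+* A) =
    (τ : B →+* B).comp (algebraMap A B) from RingHom.ext fun a => (h a).symm]
  have := Polynomial.hom_eval₂ p (algebraMap A B) (τ : B →+* B) x
  rw [hx, map_zero] at this
  exact this.symm

/-- The automorphism of the integral closure induced by a semilinear automorphism. -/
def integralClosureAut (h : IsDifferenceExt σ τ) : integralClosure A B ≃+* integralClosure A B where
  toFun x := ⟨τ x, h.isIntegral_apply x.2⟩
  invFun x := ⟨τ.symm x, h.symm.isIntegral_apply x.2⟩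
  left_inv x := Subtype.ext (τ.symm_apply_apply x)
  right_inv x := Subtype.ext (τ.apply_symm_apply x)
  map_add' x y := Subtype.ext (map_add τ (x : B) y)
  map_mul' x y := Subtype.ext (map_mul τ (x : B) y)

/-- An automorphism of a domain extends to the algebraic closure of its fraction field. -/
theorem exists_extend_algebraicClosure (B : Type*) [CommRing B] [IsDomain B] (τ : B ≃+* B) :
    ∃ τ' : AlgebraicClosure (FractionRing B) ≃+* AlgebraicClosure (FractionRing B),
      ∀ b, τ' (algebraMap B _ b) = algebraMap B _ (τ b) := by
  let τ₁ : FractionRing B ≃+* FractionRing B := IsFractionRing.ringEquivOfRingEquiv τ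
  refine ⟨IsAlgClosure.equivOfEquiv _ _ τ₁, fun b => ?_⟩
  rw [IsScalarTower.algebraMap_apply B (FractionRing B) (AlgebraicClosure (FractionRing B)),
    IsAlgClosure.equivOfEquiv_algebraMap, IsFractionRing.ringEquivOfRingEquiv_algebraMap]
  rfl

/-- A prime of `A` is the kernel on `A` of a homomorphism from an integral extension to the
algebraic closure of the residue field. -/
theorem exists_algHom_algebraicClosure [IsDomain B] [FaithfulSMul A B] [Algebra.IsIntegral A B]
    (P : Ideal A) [P.IsPrime] : Nonempty (B →ₐ[A] AlgebraicClosure (FractionRing (A ⧸ P))) := by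
  obtain ⟨Q, hQ, hQP⟩ := Ideal.exists_ideal_over_prime_of_isIntegral_of_isDomain (S := B) P (by
    rw [(RingHom.injective_iff_ker_eq_bot _).1 (FaithfulSMul.algebraMap_injective A B)]
    exact bot_le)
  have : Q.LiesOver P := ⟨hQP.symm⟩
  have : Module.IsTorsionFree (A ⧸ P) (AlgebraicClosure (FractionRing (A ⧸ P))) := by
    have := FaithfulSMul.trans (A ⧸ P) (FractionRing (A ⧸ P))
      (AlgebraicClosure (FractionRing (A ⧸ P)))
    infer_instance
  have : Module.IsTorsionFree (A ⧸ P) (B ⧸ Q) := by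
    rw [Module.isTorsionFree_iff_algebraMap_injective, injective_iff_map_eq_zero]
    intro x hx
    obtain ⟨a, rfl⟩ := Ideal.Quotient.mk_surjective x
    have h : algebraMap A B a ∈ Q := Ideal.Quotient.eq_zero_iff_mem.1 hx
    exact Ideal.Quotient.eq_zero_iff_mem.2 (hQP ▸ Ideal.mem_comap.2 h)
  let f : (B ⧸ Q) →ₐ[A ⧸ P] AlgebraicClosure (FractionRing (A ⧸ P)) := IsAlgClosed.lift
  exact ⟨(f.restrictScalars A).comp (Ideal.Quotient.mkₐ A Q)⟩

end Extend

/-- If `S` is a difference domain that is integral over a normal difference domain `A` containing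
an infinite field, and `c` is a finite tuple of `S`, then prime `σ`-ideals of `A` extend to prime
`σ ^ ℓ`-ideals of the `σ ^ ℓ`-difference ring generated by `A` and `c`, for some `ℓ ≥ 1`. -/
theorem exists_prime_sigmaIdeal {k A S : Type*} [Field k] [Infinite k] [CommRing A] [IsDomain A]
    [IsIntegrallyClosed A] [Algebra k A] [CommRing S] [IsDomain S] [Algebra A S] [FaithfulSMul A S]
    [Algebra.IsIntegral A S] {σ : A ≃+* A} {τ : S ≃+* S} (hτ : IsDifferenceExt σ τ) {r : ℕ}
    (c : Fin r → S) (P : Ideal A) [hP : P.IsPrime] (hPσ : IsSigmaIdeal σ P) :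
    ∃ ℓ : ℕ, 1 ≤ ℓ ∧ ∀ X : Set S, X ⊆ Set.range (algebraMap A S) ∪ Set.range c →
      ∃ Q : Ideal (diffSubring (τ ^ ℓ) X), Q.IsPrime ∧ IsSigmaIdeal (diffSubringAut (τ ^ ℓ) X) Q ∧
        ∀ (a : A) (h : algebraMap A S a ∈ diffSubring (τ ^ ℓ) X), ⟨_, h⟩ ∈ Q ↔ a ∈ P := by
  classical
  let Ω := AlgebraicClosure (FractionRing S)
  have : Algebra.IsAlgebraic S (FractionRing S) :=
    IsLocalization.isAlgebraic (FractionRing S) (nonZeroDivisors S)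
  have : Algebra.IsAlgebraic S Ω := Algebra.IsAlgebraic.trans S (FractionRing S) Ω
  have : Algebra.IsAlgebraic A Ω := Algebra.IsAlgebraic.trans A S Ω
  have : FaithfulSMul S Ω := FaithfulSMul.trans S (FractionRing S) Ω
  have : FaithfulSMul A Ω := FaithfulSMul.trans A S Ω
  let B := integralClosure A Ω
  obtain ⟨τΩ, hτΩ⟩ := exists_extend_algebraicClosure S τ
  have hτΩ' : IsDifferenceExt σ τΩ := fun a => by
    rw [IsScalarTower.algebraMap_apply A S Ω, hτΩ, hτ, ← IsScalarTower.algebraMap_apply A S Ω]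
  let τB : B ≃+* B := integralClosureAut hτΩ'
  have hτB : IsDifferenceExt σ τB := fun a => Subtype.ext (hτΩ' a)
  let inc : S →ₐ[A] B := (IsScalarTower.toAlgHom A S Ω).codRestrict B fun s =>
    (Algebra.IsIntegral.isIntegral (R := A) s).map _
  -- Stated with `B` as an `S`-algebra, so that compatibility passes to integer powers by
  -- `IsDifferenceExt.zpow`.
  have hinc : (letI := inc.toRingHom.toAlgebra; IsDifferenceExt τ τB) :=
    fun s => Subtype.ext (hτΩ s)
  let Λ := AlgebraicClosure (FractionRing (A ⧸ P))
  have : FaithfulSMul (A ⧸ P) Λ := FaithfulSMul.trans (A ⧸ P) (FractionRing (A ⧸ P)) Λ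
  have hΛ (a : A) : algebraMap A Λ a = 0 ↔ a ∈ P := by
    rw [IsScalarTower.algebraMap_apply A (A ⧸ P) Λ, FaithfulSMul.algebraMap_eq_zero_iff,
      Ideal.Quotient.algebraMap_eq, Ideal.Quotient.eq_zero_iff_mem]
  obtain ⟨ρ, hρ⟩ := exists_extend_algebraicClosure (A ⧸ P) (Ideal.quotientEquiv P P σ hPσ.symm)
  have hρ' : IsDifferenceExt σ ρ := fun a => by
    rw [IsScalarTower.algebraMap_apply A (A ⧸ P) Λ, hρ, IsScalarTower.algebraMap_apply A (A ⧸ P) Λ]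
    rfl
  obtain ⟨φ⟩ := exists_algHom_algebraicClosure (A := A) (B := B) P
  obtain ⟨Y, hcY, hY⟩ := exists_finset_stable (A := A) B (Finset.univ.image fun i => inc (c i))
  obtain ⟨ℓ, hℓ, hper⟩ := exists_periodic (A := A) hY hτB hρ'
    (exists_algEquiv_comp_apply_finset (k := k)) φ
  choose g hg using hper
  refine ⟨ℓ, hℓ, fun X hX => ?_⟩
  -- the limiting value of `φ ∘ g J` on an element of `S`
  let V : S → Λ → Prop := fun x v => ∀ᶠ J in Filter.atTop, φ (g J (inc x)) = v
  have hV_unique {x v w} (h1 : V x v) (h2 : V x w) : v = w := by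
    obtain ⟨J, h1, h2⟩ := (h1.and h2).exists
    exact h1.symm.trans h2
  have hV_add {x y v w} (h1 : V x v) (h2 : V y w) : V (x + y) (v + w) := by
    filter_upwards [h1, h2] with J h1 h2
    rw [map_add, map_add, map_add, h1, h2]
  have hV_mul {x y v w} (h1 : V x v) (h2 : V y w) : V (x * y) (v * w) := by
    filter_upwards [h1, h2] with J h1 h2
    rw [map_mul, map_mul, map_mul, h1, h2]
  have hV_neg {x v} (h1 : V x v) : V (-x) (-v) := by
    filter_upwards [h1] with J h1
    rw [map_neg, map_neg, map_neg, h1]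
  have hV_alg (a : A) : V (algebraMap A S a) (algebraMap A Λ a) :=
    Filter.Eventually.of_forall fun J => by
      rw [inc.commutes, (g J).commutes, φ.commutes]
  have hzpow (j : ℤ) (x : S) : inc ((τ ^ j) x) = (τB ^ j) (inc x) := by
    let := inc.toRingHom.toAlgebra
    exact (hinc.zpow j x).symm
  have hV_c (i : Fin r) (t : ℤ) : V ((τ ^ (ℓ * t)) (c i)) ((ρ ^ (ℓ * t)) (φ (inc (c i)))) := by
    filter_upwards [Filter.eventually_ge_atTop ({t} : Finset ℤ)] with J hJ
    rw [hzpow]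
    exact hg J t (hJ (Finset.mem_singleton_self t)) _
      (hcY (Finset.mem_image_of_mem _ (Finset.mem_univ i)))
  -- Limits exist on the generators, hence on the ring they generate. The second condition says that
  -- the limit homomorphism intertwines `τ ^ ℓ` and `ρ ^ ℓ`, which makes its kernel a `τ ^ ℓ`-ideal.
  have hV (x : S) (hx : x ∈ diffSubring (τ ^ ℓ) X) :
      ∃ v, V x v ∧ V ((τ ^ ℓ) x) ((ρ ^ ℓ) v) := by
    unfold diffSubring at hx
    induction hx using Subring.closure_induction with
    | mem y hy =>
      obtain ⟨j, x, hx, rfl⟩ := hy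
      have e1 : ((τ ^ ℓ) ^ j) x = (τ ^ (ℓ * j : ℤ)) x := by rw [zpow_mul, zpow_natCast]
      have e2 : (τ ^ ℓ) (((τ ^ ℓ) ^ j) x) = (τ ^ (ℓ * (j + 1) : ℤ)) x := by
        rw [e1, ← zpow_natCast τ ℓ, ← RingEquiv.zpow_add_apply]
        ring_nf
      rw [e2, e1]
      rcases hX hx with ⟨a, rfl⟩ | ⟨i, rfl⟩
      · refine ⟨algebraMap A Λ ((σ ^ (ℓ * j : ℤ)) a), ?_, ?_⟩
        · rw [hτ.zpow]
          exact hV_alg _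
        · have := hρ'.zpow ℓ ((σ ^ (ℓ * j : ℤ)) a)
          rw [zpow_natCast] at this
          rw [hτ.zpow, this, ← RingEquiv.zpow_add_apply, show (ℓ : ℤ) * (j + 1) = ℓ + ℓ * j by ring]
          exact hV_alg _
      · refine ⟨_, hV_c i j, ?_⟩
        rw [← zpow_natCast ρ ℓ, ← RingEquiv.zpow_add_apply,
          show (ℓ : ℤ) + ℓ * j = ℓ * (j + 1) by ring]
        exact hV_c i (j + 1)
    | zero => exact ⟨0, by simpa using hV_alg 0, by simpa using hV_alg 0⟩
    | one => exact ⟨1, by simpa using hV_alg 1, by simpa using hV_alg 1⟩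
    | add x y _ _ h1 h2 =>
      obtain ⟨v, hv, hv'⟩ := h1
      obtain ⟨w, hw, hw'⟩ := h2
      exact ⟨v + w, hV_add hv hw, by rw [map_add, map_add]; exact hV_add hv' hw'⟩
    | neg x _ h =>
      obtain ⟨v, hv, hv'⟩ := h
      exact ⟨-v, hV_neg hv, by rw [map_neg, map_neg]; exact hV_neg hv'⟩
    | mul x y _ _ h1 h2 =>
      obtain ⟨v, hv, hv'⟩ := h1
      obtain ⟨w, hw, hw'⟩ := h2
      exact ⟨v * w, hV_mul hv hw, by rw [map_mul, map_mul]; exact hV_mul hv' hw'⟩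
  have hV_zero : V 0 0 := by simpa using hV_alg 0
  let Q : Ideal (diffSubring (τ ^ ℓ) X) :=
    { carrier := {x | V x 0}
      add_mem' := fun {x y} hx hy => by simpa using hV_add hx hy
      zero_mem' := hV_zero
      smul_mem' := fun x y hy => by
        obtain ⟨v, hv, -⟩ := hV x x.2
        simpa using hV_mul hv hy }
  refine ⟨Q, ⟨fun htop => ?_, fun {x y} hxy => ?_⟩, isSigmaIdeal_iff.2 fun x => ?_, fun a h => ?_⟩
  · have h1 : V 1 0 := (Ideal.eq_top_iff_one Q).1 htop
    have h2 : V 1 1 := by simpa using hV_alg 1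
    exact zero_ne_one (hV_unique h1 h2)
  · obtain ⟨v, hv, -⟩ := hV x x.2
    obtain ⟨w, hw, -⟩ := hV y y.2
    have h0 : V (x * y) 0 := hxy
    rcases mul_eq_zero.1 (hV_unique (hV_mul hv hw) h0) with rfl | rfl
    · exact Or.inl hv
    · exact Or.inr hw
  · obtain ⟨v, hv, hv'⟩ := hV x x.2
    constructor
    · intro h
      have := hV_unique hv' h
      rw [map_eq_zero_iff _ (RingEquiv.injective _)] at this
      rw [this] at hv
      exact hv
    · intro h
      have := hV_unique hv h
      rw [this, map_zero] at hv'
      exact hv'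
  · rw [← hΛ]
    exact ⟨fun h => hV_unique (hV_alg a) h, fun h => by
      have := hV_alg a
      rw [h] at this
      exact this⟩

/-! ### Normality of base changes over a perfect field -/

section Normality

open scoped TensorProduct

/-- A domain is integrally closed if every finite subset lies in an integrally closed subring. -/
theorem IsIntegrallyClosed.of_forall_finset {D : Type*} [CommRing D] [IsDomain D]
    (h : ∀ s : Finset D, ∃ D' : Subring D, (s : Set D) ⊆ D' ∧ IsIntegrallyClosed D') :
    IsIntegrallyClosed D := by
  classical
  let L := FractionRing D
  rw [isIntegrallyClosed_iff L]
  rintro x ⟨p, hp, hpx⟩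
  obtain ⟨u, v, hv, rfl⟩ := IsFractionRing.div_surjective (A := D) x
  -- The subring contains the integral equation as well as the numerator and denominator of `x`, so
  -- the whole question descends to `D'`.
  obtain ⟨D', hs, hD'⟩ := h (p.coeffs ∪ {u, v})
  simp only [Finset.coe_union, Finset.coe_insert, Finset.coe_singleton, Set.union_subset_iff,
    Set.insert_subset_iff, Set.singleton_subset_iff, SetLike.mem_coe] at hs
  obtain ⟨hps, hu, hv'⟩ := hs
  have : FaithfulSMul D' L := by
    rw [faithfulSMul_iff_algebraMap_injective]
    exact (IsFractionRing.injective D L).comp Subtype.val_injective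
  let : Algebra (FractionRing D') L := FractionRing.liftAlgebra D' L
  have : IsScalarTower D' (FractionRing D') L := FractionRing.isScalarTower_liftAlgebra D' L
  let x' : FractionRing D' := algebraMap D' _ ⟨u, hu⟩ / algebraMap D' _ ⟨v, hv'⟩
  have hx' : algebraMap (FractionRing D') L x' = algebraMap D L u / algebraMap D L v := by
    rw [map_div₀, ← IsScalarTower.algebraMap_apply, ← IsScalarTower.algebraMap_apply]
    rfl
  have hint : IsIntegral D' x' := by
    rw [← isIntegral_algebraMap_iff (algebraMap (FractionRing D') L).injective, hx']
    refine ⟨p.toSubring D' hps, (p.monic_toSubring D' hps).2 hp, ?_⟩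
    have e : (p.toSubring D' hps).map D'.subtype = p := p.map_toSubring D' hps
    rw [← hpx]
    conv_rhs => rw [← e, Polynomial.eval₂_map]
    rfl
  obtain ⟨y, hy⟩ := (isIntegrallyClosed_iff (FractionRing D')).1 hD' hint
  refine ⟨y, ?_⟩
  rw [← hx', ← hy, ← IsScalarTower.algebraMap_apply]
  rfl

/-- A finite étale domain over a normal domain is normal. -/
theorem IsIntegrallyClosed.of_etale_of_finite (R S : Type*) [CommRing R] [IsDomain R]
    [IsIntegrallyClosed R] [CommRing S] [IsDomain S] [Algebra R S] [Algebra.Etale R S]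
    [Module.Finite R S] : IsIntegrallyClosed S := by
  let B := FractionRing R
  have hflat : Module.Flat R S := inferInstance
  have hinj : Function.Injective (algebraMap R S) :=
    Module.isTorsionFree_iff_algebraMap_injective.1 inferInstance
  have : IsLocalization (Algebra.algebraMapSubmonoid S (nonZeroDivisors R)) (S ⊗[R] B) :=
    IsLocalization.tensor B (nonZeroDivisors R)
  have hle : Algebra.algebraMapSubmonoid S (nonZeroDivisors R) ≤ nonZeroDivisors S :=
    map_le_nonZeroDivisors_of_injective _ hinj le_rfl
  have : IsDomain (S ⊗[R] B) := IsLocalization.isDomain_of_le_nonZeroDivisors _ hle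
  -- A domain integral over the field `B` is a field.
  have : IsIntegrallyClosed (S ⊗[R] B) := by
    let : Algebra B (S ⊗[R] B) := Algebra.TensorProduct.rightAlgebra
    have : Algebra.IsIntegral B (S ⊗[R] B) := ⟨fun x => by
      induction x with
      | zero => exact isIntegral_zero
      | add x y hx hy => exact hx.add hy
      | tmul s b =>
        have h : IsIntegral R (s ⊗ₜ[R] (1 : B)) :=
          (Algebra.IsIntegral.isIntegral (R := R) s).map
            (Algebra.TensorProduct.includeLeft : S →ₐ[R] S ⊗[R] B)
        have := (h.tower_top (A := B)).mul (isIntegral_algebraMap (R := B) (x := b))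
        rwa [Algebra.TensorProduct.right_algebraMap_apply, Algebra.TensorProduct.tmul_mul_tmul,
          mul_one, one_mul] at this⟩
    exact (isField_of_isIntegral_of_isField' (Field.toIsField B)).toField.instIsIntegrallyClosed
  -- Integral closure commutes with smooth base change: elements integral over `S` come from `S ⊗
  -- R'`, where `R'`, the integral closure of `R` in `B`, is the image of `R` by normality.
  have : IsIntegrallyClosedIn S (S ⊗[R] B) := by
    rw [isIntegrallyClosedIn_iff]
    refine ⟨IsLocalization.injective _ hle, fun {x} hx => ?_⟩
    obtain ⟨y, hy⟩ := (TensorProduct.toIntegralClosure_bijective_of_smooth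
      (R := R) (S := S) (B := B)).2 ⟨x, hx⟩
    have hy' : x = Algebra.TensorProduct.map (AlgHom.id S S) (integralClosure R B).val y :=
      (congrArg Subtype.val hy).symm
    rw [hy']
    clear hy hy' hx
    induction y with
    | zero => exact ⟨0, by simp⟩
    | add y z hy hz =>
      obtain ⟨a, ha⟩ := hy
      obtain ⟨b, hb⟩ := hz
      exact ⟨a + b, by rw [map_add, map_add, ha, hb]⟩
    | tmul s b =>
      obtain ⟨r, hr⟩ := (isIntegrallyClosed_iff B).1 inferInstance b.2
      refine ⟨r • s, ?_⟩
      rw [Algebra.TensorProduct.map_tmul, Subalgebra.coe_val, ← hr,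
        Algebra.TensorProduct.algebraMap_apply, Algebra.algebraMap_eq_smul_one (A := B),
        ← TensorProduct.smul_tmul]
      rfl
  exact .of_isIntegrallyClosed_of_isIntegrallyClosedIn S (S ⊗[R] B)

theorem MvPolynomial.isIntegrallyClosed (ι : Type*) [Finite ι] (A : Type*) [CommRing A] [IsDomain A]
    [IsIntegrallyClosed A] : IsIntegrallyClosed (MvPolynomial ι A) := by
  obtain ⟨n, ⟨e⟩⟩ := Finite.exists_equiv_fin ι
  suffices h : IsIntegrallyClosed (MvPolynomial (Fin n) A) from
    .of_equiv (MvPolynomial.renameEquiv A e).symm.toRingEquiv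
  clear e
  induction n with
  | zero => exact .of_equiv (MvPolynomial.isEmptyAlgEquiv A (Fin 0)).symm.toRingEquiv
  | succ n ih => exact .of_equiv (MvPolynomial.finSuccEquiv A n).symm.toRingEquiv

/-- A finite separable field extension is étale, and `F ⊗ A` is its base change to `N ⊗ A`. -/
theorem isIntegrallyClosed_tensorProduct_of_isSeparable {k F A : Type*} [Field k] [Field F]
    [Algebra k F] [CommRing A] [Algebra k A] (N : Type*) [Field N] [Algebra k N]
    [Algebra N F] [IsScalarTower k N F] [Algebra.IsSeparable N F] [Module.Finite N F]
    [IsDomain (N ⊗[k] A)] [IsIntegrallyClosed (N ⊗[k] A)] [IsDomain (F ⊗[k] A)] :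
    IsIntegrallyClosed (F ⊗[k] A) := by
  have : Algebra.FormallyEtale N F := Algebra.FormallyEtale.of_isSeparable N F
  have : Algebra.FinitePresentation N F := Algebra.FinitePresentation.of_finiteType.1 inferInstance
  have : Algebra.Etale N F := {}
  let e : (N ⊗[k] A) ⊗[N] F ≃+* F ⊗[k] A :=
    (Algebra.TensorProduct.comm N (N ⊗[k] A) F).toRingEquiv.trans
      (Algebra.TensorProduct.cancelBaseChange k N N F A).toRingEquiv
  have : IsDomain ((N ⊗[k] A) ⊗[N] F) := MulEquiv.isDomain (F ⊗[k] A) e.toMulEquiv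
  have := IsIntegrallyClosed.of_etale_of_finite (N ⊗[k] A) ((N ⊗[k] A) ⊗[N] F)
  exact .of_equiv e

/-- `N ⊗ A` is the localization of `C ⊗ A` at the nonzero elements of `C`, which are nonzerodivisors
there. -/
theorem isIntegrallyClosed_fractionRing_tensorProduct {k A : Type*} [Field k] [CommRing A]
    [IsDomain A] [Algebra k A] (C N : Type*) [CommRing C] [IsDomain C]
    [Field N] [Algebra k C] [Algebra k N] [Algebra C N] [IsScalarTower k C N] [IsFractionRing C N]
    [IsDomain (C ⊗[k] A)] [IsIntegrallyClosed (C ⊗[k] A)] :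
    IsDomain (N ⊗[k] A) ∧ IsIntegrallyClosed (N ⊗[k] A) := by
  let f : C ⊗[k] A →ₐ[C] N ⊗[k] A := Algebra.TensorProduct.map (Algebra.ofId C N) (AlgHom.id k A)
  let : Algebra (C ⊗[k] A) (N ⊗[k] A) := f.toRingHom.toAlgebra
  have : IsScalarTower C (C ⊗[k] A) (N ⊗[k] A) := .of_algebraMap_eq' f.comp_algebraMap.symm
  have hloc := IsLocalization.tensorProduct_tensorProduct k A (nonZeroDivisors C) N (by
    ext a
    simp [RingHom.algebraMap_toAlgebra, f])
  have hle : Algebra.algebraMapSubmonoid (C ⊗[k] A) (nonZeroDivisors C) ≤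
      nonZeroDivisors (C ⊗[k] A) :=
    map_le_nonZeroDivisors_of_injective _
      (Algebra.TensorProduct.includeLeft_injective (S := C)
        (FaithfulSMul.algebraMap_injective k A)) le_rfl
  exact ⟨IsLocalization.isDomain_of_le_nonZeroDivisors _ hle,
    isIntegrallyClosed_of_isLocalization _ _ hle⟩

variable {k F A : Type*} [Field k] [Field F] [Algebra k F] [CommRing A] [IsDomain A]
  [IsIntegrallyClosed A] [Algebra k A]

open scoped IntermediateField.algebraAdjoinAdjoin in
theorem isIntegrallyClosed_adjoin_tensorProduct {ι : Type*} [Finite ι] {v : ι → F}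
    (hv : AlgebraicIndependent k v) :
    IsDomain (IntermediateField.adjoin k (Set.range v) ⊗[k] A) ∧
      IsIntegrallyClosed (IntermediateField.adjoin k (Set.range v) ⊗[k] A) := by
  let e : MvPolynomial ι A ≃+* Algebra.adjoin k (Set.range v) ⊗[k] A :=
    (MvPolynomial.algebraTensorAlgEquiv k A).symm.toRingEquiv.trans
      ((Algebra.TensorProduct.comm k A (MvPolynomial ι k)).trans
        (Algebra.TensorProduct.congr hv.aevalEquiv AlgEquiv.refl)).toRingEquiv
  have := MvPolynomial.isIntegrallyClosed ι A
  have : IsDomain (Algebra.adjoin k (Set.range v) ⊗[k] A) :=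
    MulEquiv.isDomain (MvPolynomial ι A) e.symm.toMulEquiv
  have : IsIntegrallyClosed (Algebra.adjoin k (Set.range v) ⊗[k] A) := .of_equiv e
  exact isIntegrallyClosed_fractionRing_tensorProduct (Algebra.adjoin k (Set.range v)) _

/-- Over a perfect field `F` has a separating transcendence basis. This splits the extension into a
purely transcendental one, handled by polynomial rings and localization, and a finite separable one.
-/
theorem isIntegrallyClosed_tensorProduct_of_essFiniteType [PerfectField k]
    [Algebra.EssFiniteType k F] [IsDomain (F ⊗[k] A)] : IsIntegrallyClosed (F ⊗[k] A) := by
  obtain ⟨s, hs, hsep⟩ := exists_isTranscendenceBasis_and_isSeparable_of_perfectField k F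
  have hs' := isIntegrallyClosed_adjoin_tensorProduct (A := A) hs.1
  rw [show Set.range ((↑) : s → F) = (s : Set F) by simp] at hs'
  obtain ⟨hdom, hnorm⟩ := hs'
  have : Algebra.EssFiniteType (IntermediateField.adjoin k (s : Set F)) F := .of_comp k _ F
  have : Module.Finite (IntermediateField.adjoin k (s : Set F)) F :=
    Algebra.finite_of_essFiniteType_of_isAlgebraic
  exact isIntegrallyClosed_tensorProduct_of_isSeparable (IntermediateField.adjoin k (s : Set F))

/-- A base change of a normal domain by an extension of a perfect field is normal, if it is a
domain. -/
theorem isIntegrallyClosed_tensorProduct [PerfectField k] [IsDomain (F ⊗[k] A)] :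
    IsIntegrallyClosed (F ⊗[k] A) := by
  classical
  -- `F ⊗ A` is the directed union of the base changes by finitely generated subfields; flatness
  -- makes each of them a subring.
  let f (t : Finset F) : IntermediateField.adjoin k (t : Set F) ⊗[k] A →ₐ[k] F ⊗[k] A :=
    Algebra.TensorProduct.map (IntermediateField.adjoin k (t : Set F)).val (AlgHom.id k A)
  have hf (t) : Function.Injective (f t) :=
    Module.Flat.rTensor_preserves_injective_linearMap
      (IntermediateField.adjoin k (t : Set F)).val.toLinearMap Subtype.val_injective
  have hmono {t t' : Finset F} (h : t ⊆ t') : (f t).range ≤ (f t').range := by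
    rintro _ ⟨x, rfl⟩
    refine ⟨Algebra.TensorProduct.map (IntermediateField.inclusion
      (IntermediateField.adjoin.mono k _ _ (Finset.coe_subset.2 h))) (AlgHom.id k A) x, ?_⟩
    induction x with
    | zero => simp
    | add x y hx hy => simpa using congrArg₂ (· + ·) hx hy
    | tmul x y => rfl
  have hex (d : F ⊗[k] A) : ∃ t, d ∈ (f t).range := by
    induction d with
    | zero => exact ⟨∅, zero_mem _⟩
    | add x y hx hy =>
      obtain ⟨t, ht⟩ := hx
      obtain ⟨t', ht'⟩ := hy
      exact ⟨t ∪ t', add_mem (hmono Finset.subset_union_left ht)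
        (hmono Finset.subset_union_right ht')⟩
    | tmul x y =>
      exact ⟨{x}, ⟨x, IntermediateField.subset_adjoin k _ (by simp)⟩ ⊗ₜ y, rfl⟩
  refine .of_forall_finset fun s => ?_
  choose t ht using hex
  let T := s.biUnion t
  refine ⟨(f T).range.toSubring, fun d hd => hmono (Finset.subset_biUnion_of_mem t hd) (ht d), ?_⟩
  have : Algebra.EssFiniteType k (IntermediateField.adjoin k (T : Set F)) :=
    IntermediateField.essFiniteType_iff.2 ⟨T, rfl⟩
  have : IsDomain (IntermediateField.adjoin k (T : Set F) ⊗[k] A) := (hf T).isDomain (f T).toRingHom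
  have := isIntegrallyClosed_tensorProduct_of_essFiniteType (k := k) (A := A)
    (F := IntermediateField.adjoin k (T : Set F))
  change IsIntegrallyClosed (f T).range
  let e : IntermediateField.adjoin k (T : Set F) ⊗[k] A ≃+* (f T).range :=
    (AlgEquiv.ofInjective (f T) (hf T)).toRingEquiv
  exact IsIntegrallyClosed.of_equiv
    (R := IntermediateField.adjoin k (T : Set F) ⊗[k] A) e

end Normality

/-! ### Normality of finite tensor products of fields -/

section PiTensorNormal

open scoped TensorProduct

universe u v w

section

variable {ι k : Type*} [Fintype ι] [DecidableEq ι] [CommRing k] {A : ι → Type*}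
  [∀ i, CommRing (A i)] [∀ i, Algebra k (A i)] {S : Type*} [CommRing S] [Algebra k S]

/-- The algebra homomorphism `⨂ x_i ↦ ∏ f_i(x_i)`. -/
def PiTensorProduct.prodAlgHom (f : ∀ i, A i →ₐ[k] S) : (⨂[k] i, A i) →ₐ[k] S :=
  PiTensorProduct.liftAlgHom
    ((MultilinearMap.mkPiAlgebra k ι S).compLinearMap fun i => (f i).toLinearMap)
    (by simp) (by simp [Finset.prod_mul_distrib])

theorem PiTensorProduct.prodAlgHom_comp_singleAlgHom (f : ∀ i, A i →ₐ[k] S) (i : ι) :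
    (PiTensorProduct.prodAlgHom f).comp (PiTensorProduct.singleAlgHom i) = f i := by
  ext x
  refine (PiTensorProduct.lift.tprod _).trans ?_
  simp only [MultilinearMap.compLinearMap_apply, MultilinearMap.mkPiAlgebra_apply,
    AlgHom.toLinearMap_apply]
  rw [Finset.prod_eq_single i]
  · simp
  · intro j _ hj
    simp [hj]
  · simp

theorem PiTensorProduct.prodAlgHom_singleAlgHom (f : ∀ i, A i →ₐ[k] S) (i : ι) (x : A i) :
    PiTensorProduct.prodAlgHom f (PiTensorProduct.singleAlgHom i x) = f i x :=
  DFunLike.congr_fun (PiTensorProduct.prodAlgHom_comp_singleAlgHom f i) x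

end

section

variable {k : Type*} [CommRing k] {n : ℕ} (A : Fin (n + 1) → Type*) [∀ i, CommRing (A i)]
  [∀ i, Algebra k (A i)]

/-- The algebra homomorphism `x_0 ⊗ ⋯ ⊗ x_n ↦ x_0 ⊗ (x_1 ⊗ ⋯ ⊗ x_n)`. -/
def PiTensorProduct.finSuccHom : (⨂[k] i, A i) →ₐ[k] A 0 ⊗[k] (⨂[k] i : Fin n, A i.succ) :=
  prodAlgHom (Fin.cases (motive := fun i => A i →ₐ[k] A 0 ⊗[k] (⨂[k] i : Fin n, A i.succ))
    Algebra.TensorProduct.includeLeft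
    fun i => Algebra.TensorProduct.includeRight.comp
      (singleAlgHom (R := k) (A := fun i : Fin n => A i.succ) i))

/-- The algebra homomorphism `x_0 ⊗ (x_1 ⊗ ⋯ ⊗ x_n) ↦ x_0 ⊗ ⋯ ⊗ x_n`. -/
def PiTensorProduct.finSuccInv : A 0 ⊗[k] (⨂[k] i : Fin n, A i.succ) →ₐ[k] (⨂[k] i, A i) :=
  Algebra.TensorProduct.lift (singleAlgHom (R := k) (A := A) 0)
    (prodAlgHom fun i => singleAlgHom (R := k) (A := A) i.succ) fun _ _ => Commute.all _ _

theorem PiTensorProduct.finSuccHom_zero (x : A 0) :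
    finSuccHom (k := k) A (singleAlgHom (R := k) 0 x) = x ⊗ₜ 1 :=
  prodAlgHom_singleAlgHom _ _ _

theorem PiTensorProduct.finSuccHom_succ (i : Fin n) (x : A i.succ) :
    finSuccHom (k := k) A (singleAlgHom (R := k) i.succ x) =
      1 ⊗ₜ singleAlgHom (R := k) (A := fun i : Fin n => A i.succ) i x :=
  prodAlgHom_singleAlgHom _ _ _

theorem PiTensorProduct.finSuccInv_zero (x : A 0) :
    finSuccInv (k := k) A (x ⊗ₜ 1) = singleAlgHom 0 x := by
  rw [finSuccInv, Algebra.TensorProduct.lift_tmul, map_one, mul_one]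

theorem PiTensorProduct.finSuccInv_succ (i : Fin n) (x : A i.succ) :
    finSuccInv (k := k) A (1 ⊗ₜ singleAlgHom (R := k) (A := fun i : Fin n => A i.succ) i x) =
      singleAlgHom i.succ x := by
  rw [finSuccInv, Algebra.TensorProduct.lift_tmul, map_one, one_mul, prodAlgHom_singleAlgHom]

/-- `⨂_{i ≤ n} A_i` is the tensor product of `A_0` and the tensor product of the others. -/
def PiTensorProduct.finSuccAlgEquiv :
    (⨂[k] i, A i) ≃ₐ[k] A 0 ⊗[k] (⨂[k] i : Fin n, A i.succ) :=
  AlgEquiv.ofAlgHom (finSuccHom A) (finSuccInv A)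
    (Algebra.TensorProduct.ext
      (AlgHom.ext fun x => by
        change finSuccHom (k := k) A (finSuccInv (k := k) A (x ⊗ₜ 1)) = x ⊗ₜ 1
        rw [finSuccInv_zero, finSuccHom_zero])
      (PiTensorProduct.algHom_ext fun i => AlgHom.ext fun x => by
        change finSuccHom (k := k) A (finSuccInv (k := k) A (1 ⊗ₜ singleAlgHom (R := k)
          (A := fun i : Fin n => A i.succ) i x)) = 1 ⊗ₜ singleAlgHom (R := k)
          (A := fun i : Fin n => A i.succ) i x
        rw [finSuccInv_succ, finSuccHom_succ]))
    (PiTensorProduct.algHom_ext fun i => AlgHom.ext fun x => by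
      change finSuccInv (k := k) A (finSuccHom (k := k) A (singleAlgHom i x)) = singleAlgHom i x
      induction i using Fin.cases with
      | zero => rw [finSuccHom_zero, finSuccInv_zero]
      | succ i => rw [finSuccHom_succ, finSuccInv_succ])

end

/-- The tensor product of a normal domain and finitely many fields over a perfect field is normal,
if it is a domain. -/
theorem isIntegrallyClosed_tensorProduct_piTensorProduct {k : Type u} [Field k] [PerfectField k]
    (n : ℕ) (F : Fin n → Type v) [∀ i, Field (F i)] [∀ i, Algebra k (F i)] (A : Type max v w)
    [CommRing A] [IsDomain A] [IsIntegrallyClosed A] [Algebra k A] [IsDomain (A ⊗[k] (⨂[k] i, F i))] :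
    IsIntegrallyClosed (A ⊗[k] (⨂[k] i, F i)) := by
  induction n generalizing A with
  | zero =>
    let e : A ≃+* A ⊗[k] (⨂[k] i, F i) := ((Algebra.TensorProduct.rid k A A).symm.trans
      (Algebra.TensorProduct.congr AlgEquiv.refl (AlgEquiv.ofBijective
        (Algebra.ofId k (⨂[k] i, F i)) (by
          convert (PiTensorProduct.isEmptyEquiv (R := k) (s := F) (Fin 0)).symm.bijective using 1
          ext x
          rw [Algebra.ofId_apply, Algebra.algebraMap_eq_smul_one, PiTensorProduct.one_def]
          change _ = x • PiTensorProduct.tprod k isEmptyElim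
          congr 2
          exact Subsingleton.elim _ _)))).toRingEquiv
    exact .of_equiv e
  | succ n ih =>
    let e : A ⊗[k] (⨂[k] i, F i) ≃+* (A ⊗[k] F 0) ⊗[k] (⨂[k] i : Fin n, F i.succ) :=
      ((Algebra.TensorProduct.congr AlgEquiv.refl (PiTensorProduct.finSuccAlgEquiv F)).trans
        (Algebra.TensorProduct.assoc k k k A (F 0) _).symm).toRingEquiv
    have hdom : IsDomain ((A ⊗[k] F 0) ⊗[k] (⨂[k] i : Fin n, F i.succ)) :=
      MulEquiv.isDomain (A ⊗[k] (⨂[k] i, F i)) e.symm.toMulEquiv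
    have : Nontrivial (⨂[k] i : Fin n, F i.succ) := by
      by_contra h
      rw [not_nontrivial_iff_subsingleton] at h
      exact not_subsingleton ((A ⊗[k] F 0) ⊗[k] (⨂[k] i : Fin n, F i.succ)) inferInstance
    -- The induction absorbs `F 0` into `A`; the new `A` is a domain because it embeds in the full
    -- tensor product.
    have : IsDomain (A ⊗[k] F 0) :=
      (Algebra.TensorProduct.includeLeft_injective (R := k) (S := k) (A := A ⊗[k] F 0)
        (B := ⨂[k] i : Fin n, F i.succ) (FaithfulSMul.algebraMap_injective k _)).isDomain
        (Algebra.TensorProduct.includeLeft (R := k) (S := k)).toRingHom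
    let c : A ⊗[k] F 0 ≃+* F 0 ⊗[k] A := (Algebra.TensorProduct.comm k A (F 0)).toRingEquiv
    have : IsDomain (F 0 ⊗[k] A) := MulEquiv.isDomain (A ⊗[k] F 0) c.symm.toMulEquiv
    have : IsIntegrallyClosed (F 0 ⊗[k] A) := isIntegrallyClosed_tensorProduct
    have : IsIntegrallyClosed (A ⊗[k] F 0) := .of_equiv c.symm
    have := ih (fun i => F i.succ) (A ⊗[k] F 0)
    exact .of_equiv e.symm

theorem TensorRing.isIntegrallyClosed {k : Type u} {K : Type w} [Field k] [PerfectField k] [Field K]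
    [Algebra k K] {n : ℕ} (F : Fin n → Type v) [∀ i, Field (F i)] [∀ i, Algebra k (F i)]
    [IsDomain (TensorRing k K F)] : IsIntegrallyClosed (TensorRing k K F) := by
  -- In the induction `A` must live in a universe that also contains the factors it absorbs, hence
  -- the lift of `K`.
  let e : ULift.{v} K ⊗[k] (⨂[k] i, F i) ≃+* TensorRing k K F :=
    (Algebra.TensorProduct.congr (ULift.algEquiv (R := k)) AlgEquiv.refl).toRingEquiv
  have : IsDomain (ULift.{v} K ⊗[k] (⨂[k] i, F i)) :=
    MulEquiv.isDomain (TensorRing k K F) e.toMulEquiv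
  have : IsDomain (ULift.{v} K) := MulEquiv.isDomain K ULift.ringEquiv.toMulEquiv
  have : IsIntegrallyClosed (ULift.{v} K) := .of_equiv (ULift.ringEquiv (R := K)).symm
  have := isIntegrallyClosed_tensorProduct_piTensorProduct.{u, v, w} (k := k) n F (ULift.{v} K)
  exact .of_equiv e

end PiTensorNormal

/-! ### Application to coordinate rings -/

/-- A difference ring generated by elements integral over a difference subring is integral. -/
theorem isIntegral_of_mem_diffSubring {A S : Type*} [CommRing A] [CommRing S] [Algebra A S]
    {σ : A ≃+* A} {τ : S ≃+* S} (hτ : IsDifferenceExt σ τ) {X : Set S}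
    (hX : ∀ x ∈ X, IsIntegral A x) {x : S} (hx : x ∈ diffSubring τ X) : IsIntegral A x := by
  unfold diffSubring at hx
  induction hx using Subring.closure_induction with
  | mem y hy =>
    obtain ⟨j, x, hx, rfl⟩ := hy
    exact (hτ.zpow j).isIntegral_apply (hX x hx)
  | zero => exact isIntegral_zero
  | one => exact isIntegral_one
  | add x y _ _ h1 h2 => exact h1.add h2
  | neg x _ h => exact h.neg
  | mul x y _ _ h1 h2 => exact h1.mul h2

theorem CoordRing.isIntegrallyClosed {k K Ω : Type*} [Field k] [PerfectField k] [Field K] [Field Ω]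
    [Algebra k K] [Algebra k Ω] (σ : Ω ≃+* Ω) {n : ℕ} {d : Fin n → ℕ} (a : ∀ i, Fin (d i) → Ω)
    [h : IsDomain (CoordRing k K σ a)] : IsIntegrallyClosed (CoordRing k K σ a) :=
  have : IsDomain (TensorRing k K fun i => diffField k σ (a i)) := h
  (TensorRing.isIntegrallyClosed fun i => diffField k σ (a i) :
    IsIntegrallyClosed (TensorRing k K fun i => diffField k σ (a i)))

theorem lemma2p2
    {k K Ω : Type*} [Field k] [IsAlgClosed k] [Field K] [Field Ω] [Algebra k K] [Algebra k Ω]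
    {σk : k ≃+* k} {σK : K ≃+* K} {σ : Ω ≃+* Ω}
    (hK : IsDifferenceExt σk σK) (hΩ : IsDifferenceExt σk σ)
    {n : ℕ} {d : Fin n → ℕ} (a : ∀ i, Fin (d i) → Ω)
    {S : Type*} [CommRing S] [IsDomain S] [Algebra (CoordRing k K σ a) S]
    [FaithfulSMul (CoordRing k K σ a) S]
    (τ : S ≃+* S) (hτ : IsDifferenceExt (coordAut hK hΩ a) τ)
    {r : ℕ} (c : Fin r → S)
    (hc : Algebra.IsIntegral (coordBase k K σ a) (Algebra.adjoin (coordBase k K σ a) (Set.range c)))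
    (hS : extPow k K σ a τ c 1 = ⊤)
    (P : Ideal (CoordRing k K σ a)) (hP : P.IsPrime) (hPσ : IsSigmaIdeal (coordAut hK hΩ a) P) :
    ∃ ℓ : ℕ, 1 ≤ ℓ ∧ ∃ Q : Ideal (extPow k K σ a τ c ℓ),
      Q.IsPrime ∧ IsSigmaIdeal (extPowAut k K σ a τ c ℓ) Q ∧
        Q.comap (extPowMap k K σ a τ c ℓ) = P.comap (coordPow k K σ a ℓ).val := by
  have : IsDomain (CoordRing k K σ a) :=
    (FaithfulSMul.algebraMap_injective (CoordRing k K σ a) S).isDomain (algebraMap _ S)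
  have := CoordRing.isIntegrallyClosed (k := k) (K := K) σ a
  have : Infinite k := IsAlgClosed.instInfinite
  have : Infinite K := Infinite.of_injective _ (algebraMap k K).injective
  have hcA (i : Fin r) : IsIntegral (CoordRing k K σ a) (c i) :=
    ((hc.isIntegral ⟨c i, Algebra.subset_adjoin ⟨i, rfl⟩⟩).map (Subalgebra.val _)).tower_top
  have : Algebra.IsIntegral (CoordRing k K σ a) S := ⟨fun x => by
    have hx : x ∈ extPow k K σ a τ c 1 := hS ▸ Subring.mem_top x
    rw [extPow, pow_one] at hx
    refine isIntegral_of_mem_diffSubring hτ ?_ hx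
    rintro _ (⟨b, -, rfl⟩ | ⟨i, rfl⟩)
    · exact isIntegral_algebraMap
    · exact hcA i⟩
  -- The general result is applied over all of `R_σ`. Its `ℓ` works for every generating set made of
  -- elements of `R_σ` and `c`, so the set may afterwards be chosen to depend on `ℓ`.
  obtain ⟨ℓ, hℓ, h⟩ := exists_prime_sigmaIdeal (k := K) hτ c P hPσ
  obtain ⟨Q, hQ, hQσ, hQP⟩ := h (extGen k K σ a c ℓ)
    (Set.union_subset_union_left _ (Set.image_subset_range _ _))
  exact ⟨ℓ, hℓ, Q, hQ, hQσ, Ideal.ext fun x => hQP x _⟩
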